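/- Let $1\le k\le\infty$, and order $\mathbb N^{\oplus k}$ (where $0\in\mathbb N$) coordinatewise, with join $\vee$. Let $A$ be a $C^*$-algebra. For a right Hilbert $A$-module $Y$ let $\mathcal L(Y)$ be the $C^*$-algebra of adjointable operators on $Y$ and $\mathcal K(Y)$ the closed linear span of the rank-one operators $\theta_{\xi,\eta}\colon\zeta\mapsto\xi\langle\eta,\zeta\rangle$; for an ideal $I$ of $A$ put $YI=\{\xi\in Y:\langle\xi,\xi\rangle\in I\}$. A Hilbert $A$-bimodule is a right Hilbert $A$-module $Y$ with a $*$-homomorphism $A\to\mathcal L(Y)$. A product system $X$ over $\mathbb N^{\oplus k}$ of Hilbert $A$-bimodules is a semigroup fibred by $\mathbb N^{\oplus k}$, with bilinear multiplications $X_m\times X_n\to X_{m+n}$, whose fibres $X_n$ are Hilbert $A$-bimodules (with left actions $\phi_n\colon A\to\mathcal L(X_n)$), such that $X_0={}_AA_A$, multiplication by elements of $X_0=A$ from the left and from the right is the left and the right action of $A$, and for $m,n\ne0$ the map $\xi\otimes\eta\mapsto\xi\eta$ induces an isomorphism $M_{m,n}\colon X_m\otimes_AX_n\to X_{m+n}$.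 For $n\le m$ let $\iota_n^m\colon\mathcal K(X_n)\to\mathcal L(X_m)$ be $S\mapsto M_{n,m-n}(S\otimes1)M_{n,m-n}^{-1}$ if $0<n<m$, the identity $S\mapsto S$ if $n=m$, and $L_a\mapsto\phi_m(a)$ if $n=0$, where $L_a$ is left multiplication by $a\in A$. The system $X$ is compactly aligned if $\iota_m^{m\vee n}(S)\,\iota_n^{m\vee n}(T)\in\mathcal K(X_{m\vee n})$ for all $m,n$, $S\in\mathcal K(X_m)$ and $T\in\mathcal K(X_n)$. Assume this from now on. Let $I_0=A$ and $I_n=\bigcap_{0<m\le n}\ker\phi_m$ for $n\ne0$, and let $C_q=\bigoplus_{0\le r\le q}\mathcal L(X_rI_{q-r})$. For $S\in\mathcal K(X_p)$ let $\widetilde\iota_p^{\,q}(S)\in C_q$ be the element with component $\iota_p^r(S)|_{X_rI_{q-r}}$ at $r$ if $p\le r$, and $0$ otherwise. For $n\in\mathbb N^{\oplus k}$ let $$\widetilde C_n=\Bigl\{\Bigl(\sum_{p\le n}\widetilde\iota_p^{\,q}(S_p)\Bigr)_{q\ge n}\ :\ S_p\in\mathcal K(X_p)\text{ for }p\le n\Bigr\}\subset\prod_{q\ge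 n}C_q$$ (the $C^*$-algebra of bounded families), and for $n\le m$ let $\widetilde j_{m,n}\colon\widetilde C_n\to\widetilde C_m$ be the $*$-homomorphism that restricts a family to the indices $q\ge m$. Let $\varinjlim\widetilde C_n$ be the inductive limit $C^*$-algebra of the system $(\widetilde C_n,\widetilde j_{m,n})$. A representation $\psi$ of $X$ in a $C^*$-algebra $B$ consists of linear maps $\psi_n\colon X_n\to B$ such that $\psi_0$ is a $*$-homomorphism on $A$, $\psi_n(\xi)^*\psi_n(\eta)=\psi_0(\langle\xi,\eta\rangle)$, $\psi_0(a)\psi_n(\xi)=\psi_n(a\xi)$, and $\psi_m(\xi)\psi_n(\eta)=\psi_{m+n}(\xi\eta)$. It is injective if $\psi_0$ is injective. Let $\psi^{(n)}\colon\mathcal K(X_n)\to B$ be the $*$-homomorphism with $\psi^{(n)}(\theta_{\xi,\eta})=\psi_n(\xi)\psi_n(\eta)^*$, and let the core $C^*(\psi)^{\mathrm{core}}$ be the closed linear span of $\{\psi_n(\xi)\psi_n(\eta)^*: n\in\mathbb N^{\oplus k},\ \xi,\eta\in X_n\}$. The representation $\psi$ is Nica covariant if $\psi^{(m)}(S)\psi^{(n)}(T)=\psi^{(m\vee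 n)}\bigl(\iota_m^{m\vee n}(S)\,\iota_n^{m\vee n}(T)\bigr)$ for all $m,n$, $S\in\mathcal K(X_m)$ and $T\in\mathcal K(X_n)$. It is CNP-covariant if it is Nica covariant and $\sum_{p\in F}\psi^{(p)}(S_p)=0$ whenever $F\subset\mathbb N^{\oplus k}$ is finite, $S_p\in\mathcal K(X_p)$ for $p\in F$, and for every $n$ there is an $m\ge n$ such that $\sum_{p\in F}\widetilde\iota_p^{\,q}(S_p)=0$ for all $q\ge m$. **Theorem.** Let $X$ be a compactly aligned product system of Hilbert $A$-bimodules over $\mathbb N^{\oplus k}$, and let $\psi$ be an injective CNP-covariant representation of $X$ in a $C^*$-algebra $B$. Then the maps $$\widetilde\kappa_n^\psi\colon\widetilde C_n\to B,\qquad\Bigl(\sum_{p\le n}\widetilde\iota_p^{\,q}(S_p)\Bigr)_{q\ge n}\longmapsto\sum_{p\le n}\psi^{(p)}(S_p),$$ are well-defined $*$-homomorphisms with $\widetilde\kappa_m^\psi\circ\widetilde j_{m,n}=\widetilde\kappa_n^\psi$ for $n\le m$, and the unique $*$-homomorphism $\widetilde\kappa^\psi=\varinjlim\widetilde\kappa_n^\psi$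 on $\varinjlim\widetilde C_n$ that they induce is isometric and has range $C^*(\psi)^{\mathrm{core}}$. Hence $\widetilde\kappa^\psi\colon\varinjlim\widetilde C_n\to C^*(\psi)^{\mathrm{core}}$ is an isometric isomorphism from an algebra that is defined without reference to $\psi$. -/

import Mathlib

/-- A directed system of normed *-algebras whose connecting maps are contractive. -/
class ContractiveSystem {I : Type*} [Preorder I] (G : I → Type*)
    [∀ i, NonUnitalNormedRing (G i)] [∀ i, StarRing (G i)] [∀ i, NormedSpace ℂ (G i)]
    (f : ∀ i j, i ≤ j → G i →⋆ₙₐ[ℂ] G j) : Prop extends DirectedSystem G (f · · ·) where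
  norm_le : ∀ i j (h : i ≤ j) (x : G i), ‖f i j h x‖ ≤ ‖x‖

set_option linter.unusedSectionVars false

noncomputable section CStarLimit

open Filter Topology


/-- A C*-seminorm. -/
class PreCStarAlgebra (E : Type*) [NonUnitalSeminormedRing E] [StarRing E] : Prop where
  norm_star' : ∀ x : E, ‖star x‖ = ‖x‖
  norm_star_mul_self : ∀ x : E, ‖star x * x‖ = ‖x‖ * ‖x‖

section

variable (E : Type*) [NonUnitalSeminormedRing E] [StarRing E] [PreCStarAlgebra E]
  [NormedSpace ℂ E] [IsScalarTower ℂ E E] [SMulCommClass ℂ E E] [StarModule ℂ E]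

/-- The Hausdorff completion of a *-algebra with a C*-seminorm. -/
def CStarCompletion : Type _ := UniformSpace.Completion E

namespace CStarCompletion

open UniformSpace UniformSpace.Completion

instance : NormedAddCommGroup (CStarCompletion E) :=
  inferInstanceAs (NormedAddCommGroup (Completion E))
instance : NormedSpace ℂ (CStarCompletion E) :=
  inferInstanceAs (NormedSpace ℂ (Completion E))
instance : CompleteSpace (CStarCompletion E) :=
  inferInstanceAs (CompleteSpace (Completion E))

/-- The canonical map from a *-algebra with a C*-seminorm to its completion. -/
def toLim : E →L[ℂ] CStarCompletion E :=
  (toComplL : E →L[ℂ] Completion E)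

variable {E}

theorem norm_toLim (x : E) : ‖toLim E x‖ = ‖x‖ := norm_coe x

variable (E) in
theorem isDenseInducing : IsDenseInducing (toLim E) := isDenseInducing_coe

variable (E) in
theorem denseRange : DenseRange (toLim E) := (isDenseInducing E).dense

variable (E) in
/-- The multiplication of the completion, as a map on pairs. -/
def mulAux : CStarCompletion E × CStarCompletion E → CStarCompletion E :=
  ((isDenseInducing E).prodMap (isDenseInducing E)).extend (fun p => toLim E (p.1 * p.2))

instance : Mul (CStarCompletion E) := ⟨fun x y => mulAux E (x, y)⟩

theorem toLim_mul (x y : E) : toLim E (x * y) = toLim E x * toLim E y :=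
  (((isDenseInducing E).prodMap (isDenseInducing E)).extend_eq
    (f := fun p => toLim E (p.1 * p.2)) (by fun_prop) (x, y)).symm

instance : ContinuousMul (CStarCompletion E) where
  continuous_mul := by
    let m := (AddMonoidHom.mul : E →+ E →+ E).compr₂
      ((toLim E : E →ₗ[ℂ] CStarCompletion E).toAddMonoidHom)
    have hm : Continuous fun p : E × E => m p.1 p.2 :=
      (toLim E).continuous.comp continuous_mul
    have di : IsDenseInducing ((toLim E : E →ₗ[ℂ] CStarCompletion E).toAddMonoidHom) :=
      isDenseInducing E
    exact (di.extend_Z_bilin di hm :)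

variable (E) in
/-- The involution of the completion. -/
def starAux : CStarCompletion E → CStarCompletion E :=
  (isDenseInducing E).extend (fun x => toLim E (star x))

instance : Star (CStarCompletion E) := ⟨starAux E⟩

theorem continuous_star_alg : Continuous (star : E → E) :=
  AddMonoidHomClass.continuous_of_bound (starAddEquiv : E ≃+ E) 1
    fun x => by simpa using (PreCStarAlgebra.norm_star' x).le

theorem toLim_star (x : E) : toLim E (star x) = star (toLim E x) :=
  ((isDenseInducing E).extend_eq (f := fun x => toLim E (star x))
    ((toLim E).continuous.comp continuous_star_alg) x).symm

instance : ContinuousStar (CStarCompletion E) where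
  continuous_star := by
    have hu : UniformContinuous fun x : E => toLim E (star x) :=
      ((toLim E).uniformContinuous).comp
        (uniformContinuous_addMonoidHom_of_continuous
          (f := (starAddEquiv : E ≃+ E)) continuous_star_alg)
    exact uniformContinuous_uniformly_extend (isUniformInducing_coe E) (denseRange E) hu |>.continuous

@[elab_as_elim]
theorem induction_on {p : CStarCompletion E → Prop} (x : CStarCompletion E) (hp : IsClosed {x | p x})
    (h : ∀ x, p (toLim E x)) : p x :=
  (denseRange E).induction_on x hp h

theorem cont_mul {X : Type*} [TopologicalSpace X] {u v : X → CStarCompletion E} (hu : Continuous u)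
    (hv : Continuous v) : Continuous fun x => u x * v x := hu.mul hv

theorem cont_star {X : Type*} [TopologicalSpace X] {u : X → CStarCompletion E}
    (hu : Continuous u) : Continuous fun x => star (u x) := hu.star

theorem eq_of_dense {u v : CStarCompletion E → CStarCompletion E} (hu : Continuous u)
    (hv : Continuous v) (h : ∀ x, u (toLim E x) = v (toLim E x)) (x) : u x = v x :=
  induction_on x (isClosed_eq hu hv) h

theorem left_distrib' (a b c : CStarCompletion E) : a * (b + c) = a * b + a * c := by
  refine eq_of_dense (u := fun a => a * (b + c)) (v := fun a => a * b + a * c)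
    (cont_mul continuous_id continuous_const)
    ((cont_mul continuous_id continuous_const).add (cont_mul continuous_id continuous_const))
    (fun a => ?_) a
  refine eq_of_dense (u := fun b => _ * (b + c)) (v := fun b => _ * b + _ * c)
    (cont_mul continuous_const (continuous_id.add continuous_const))
    ((cont_mul continuous_const continuous_id).add continuous_const) (fun b => ?_) b
  refine eq_of_dense (u := fun c => _ * (_ + c)) (v := fun c => _ * _ + _ * c)
    (cont_mul continuous_const (continuous_const.add continuous_id))
    (continuous_const.add (cont_mul continuous_const continuous_id)) (fun c => ?_) c
  rw [← map_add, ← toLim_mul, ← toLim_mul, ← toLim_mul, mul_add, map_add]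

theorem star_mul' (a b : CStarCompletion E) : star (a * b) = star b * star a := by
  refine eq_of_dense (u := fun a => star (a * b)) (v := fun a => star b * star a)
    (cont_star (cont_mul continuous_id continuous_const))
    (cont_mul continuous_const (cont_star continuous_id)) (fun a => ?_) a
  refine eq_of_dense (u := fun b => star (_ * b)) (v := fun b => star b * star _)
    (cont_star (cont_mul continuous_const continuous_id))
    (cont_mul (cont_star continuous_id) continuous_const) (fun b => ?_) b
  rw [← toLim_mul, ← toLim_star, ← toLim_star, ← toLim_star, ← toLim_mul, star_mul]

theorem star_add' (a b : CStarCompletion E) : star (a + b) = star a + star b := by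
  refine eq_of_dense (u := fun a => star (a + b)) (v := fun a => star a + star b)
    (cont_star (continuous_id.add continuous_const))
    ((cont_star continuous_id).add continuous_const) (fun a => ?_) a
  refine eq_of_dense (u := fun b => star (_ + b)) (v := fun b => star _ + star b)
    (cont_star (continuous_const.add continuous_id))
    (continuous_const.add (cont_star continuous_id)) (fun b => ?_) b
  rw [← map_add, ← toLim_star, ← toLim_star, ← toLim_star, ← map_add, star_add]

theorem star_star' (a : CStarCompletion E) : star (star a) = a := by
  refine eq_of_dense (u := fun a => star (star a)) (v := fun a => a)
    (cont_star (cont_star continuous_id)) continuous_id (fun a => ?_) a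
  rw [← toLim_star, ← toLim_star, star_star]

theorem star_smul' (c : ℂ) (a : CStarCompletion E) : star (c • a) = star c • star a := by
  refine eq_of_dense (u := fun a => star (c • a)) (v := fun a => star c • star a)
    (cont_star (continuous_id.const_smul c)) ((continuous_const_smul (star c)).comp (cont_star continuous_id))
    (fun a => ?_) a
  rw [← map_smul, ← toLim_star, ← toLim_star, ← map_smul, star_smul]

theorem right_distrib' (a b c : CStarCompletion E) : (a + b) * c = a * c + b * c := by
  rw [← star_star' ((a + b) * c), star_mul', star_add', left_distrib', star_add', ← star_mul',
    ← star_mul', star_star', star_star']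

theorem smul_mul' (c : ℂ) (a b : CStarCompletion E) : c • a * b = c • (a * b) := by
  refine eq_of_dense (u := fun a => c • a * b) (v := fun a => c • (a * b))
    (cont_mul (continuous_id.const_smul c) continuous_const)
    ((cont_mul continuous_id continuous_const).const_smul c) (fun a => ?_) a
  refine eq_of_dense (u := fun b => c • _ * b) (v := fun b => c • (_ * b))
    (cont_mul continuous_const continuous_id)
    ((cont_mul continuous_const continuous_id).const_smul c) (fun b => ?_) b
  rw [← map_smul, ← toLim_mul, ← toLim_mul, ← map_smul, smul_mul_assoc]

theorem mul_smul' (c : ℂ) (a b : CStarCompletion E) : a * c • b = c • (a * b) := by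
  rw [← star_star' (a * c • b), star_mul', star_smul', smul_mul', star_smul', ← star_mul',
    star_star', star_star]

theorem mul_assoc' (a b c : CStarCompletion E) : a * b * c = a * (b * c) := by
  refine eq_of_dense (u := fun a => a * b * c) (v := fun a => a * (b * c))
    (cont_mul (cont_mul continuous_id continuous_const) continuous_const)
    (cont_mul continuous_id continuous_const) (fun a => ?_) a
  refine eq_of_dense (u := fun b => _ * b * c) (v := fun b => _ * (b * c))
    (cont_mul (cont_mul continuous_const continuous_id) continuous_const)
    (cont_mul continuous_const (cont_mul continuous_id continuous_const)) (fun b => ?_) b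
  refine eq_of_dense (u := fun c => _ * _ * c) (v := fun c => _ * (_ * c))
    (cont_mul continuous_const continuous_id)
    (cont_mul continuous_const (cont_mul continuous_const continuous_id)) (fun c => ?_) c
  rw [← toLim_mul, ← toLim_mul, ← toLim_mul, ← toLim_mul, mul_assoc]

theorem norm_mul_le' (a b : CStarCompletion E) : ‖a * b‖ ≤ ‖a‖ * ‖b‖ := by
  refine induction_on a (isClosed_le (cont_mul continuous_id continuous_const).norm
    (continuous_norm.mul continuous_const)) fun a => ?_
  refine induction_on b (isClosed_le (cont_mul continuous_const continuous_id).norm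
    (continuous_const.mul continuous_norm)) fun b => ?_
  rw [← toLim_mul, norm_toLim, norm_toLim, norm_toLim]
  exact norm_mul_le a b

theorem norm_star_mul_self' (a : CStarCompletion E) : ‖a‖ * ‖a‖ ≤ ‖star a * a‖ := by
  refine induction_on a (isClosed_le (continuous_norm.mul continuous_norm)
    (cont_mul (cont_star continuous_id) continuous_id).norm) fun a => ?_
  rw [← toLim_star, ← toLim_mul, norm_toLim, norm_toLim]
  exact (PreCStarAlgebra.norm_star_mul_self a).ge

instance : NonUnitalRing (CStarCompletion E) :=
  { (inferInstance : AddCommGroup (CStarCompletion E)),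
    (inferInstance : Mul (CStarCompletion E)) with
    left_distrib := left_distrib'
    right_distrib := right_distrib'
    mul_assoc := mul_assoc'
    zero_mul := fun a => by
      have h := right_distrib' 0 0 a
      rw [add_zero] at h
      exact left_eq_add.1 h
    mul_zero := fun a => by
      have h := left_distrib' a 0 0
      rw [add_zero] at h
      exact left_eq_add.1 h }

instance : NonUnitalNormedRing (CStarCompletion E) :=
  { (inferInstance : NonUnitalRing (CStarCompletion E)),
    (inferInstance : NormedAddCommGroup (CStarCompletion E)) with
    norm_mul_le := norm_mul_le' }

instance : StarRing (CStarCompletion E) where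
  star_involutive := star_star'
  star_mul := star_mul'
  star_add := star_add'

instance : CStarRing (CStarCompletion E) where
  norm_mul_self_le := norm_star_mul_self'

instance : IsScalarTower ℂ (CStarCompletion E) (CStarCompletion E) where
  smul_assoc := smul_mul'

instance : SMulCommClass ℂ (CStarCompletion E) (CStarCompletion E) where
  smul_comm c a b := (mul_smul' c a b).symm

instance : StarModule ℂ (CStarCompletion E) where
  star_smul := star_smul'

instance : NonUnitalCStarAlgebra (CStarCompletion E) where

end CStarCompletion

end

variable {I : Type*} [Preorder I] [IsDirectedOrder I] [Nonempty I] (G : I → Type*)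
  [∀ i, NonUnitalNormedRing (G i)] [∀ i, StarRing (G i)] [∀ i, CStarRing (G i)]
  [∀ i, NormedSpace ℂ (G i)] [∀ i, IsScalarTower ℂ (G i) (G i)]
  [∀ i, SMulCommClass ℂ (G i) (G i)] [∀ i, StarModule ℂ (G i)]
  (f : ∀ i j, i ≤ j → G i →⋆ₙₐ[ℂ] G j) [ContractiveSystem G f]

/-- The algebraic direct limit of the *-algebras `G i`. -/
def AlgLimit : Type _ := DirectLimit G f

namespace AlgLimit

instance : NonUnitalRing (AlgLimit G f) := inferInstanceAs (NonUnitalRing (DirectLimit G f))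
instance : StarRing (AlgLimit G f) := inferInstanceAs (StarRing (DirectLimit G f))
instance : Module ℂ (AlgLimit G f) := inferInstanceAs (Module ℂ (DirectLimit G f))
instance : IsScalarTower ℂ (AlgLimit G f) (AlgLimit G f) :=
  inferInstanceAs (IsScalarTower ℂ (DirectLimit G f) (DirectLimit G f))
instance : SMulCommClass ℂ (AlgLimit G f) (AlgLimit G f) :=
  inferInstanceAs (SMulCommClass ℂ (DirectLimit G f) (DirectLimit G f))
instance : StarModule ℂ (AlgLimit G f) := inferInstanceAs (StarModule ℂ (DirectLimit G f))

/-- The canonical map `G i → AlgLimit G f`. -/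
def of (i : I) : G i →⋆ₙₐ[ℂ] AlgLimit G f where
  toFun x := (⟦⟨i, x⟩⟧ : DirectLimit G f)
  map_smul' c x := (DirectLimit.smul_def (f := f) i x c).symm
  map_zero' := (DirectLimit.zero_def (f := f) i).symm
  map_add' x y := (DirectLimit.add_def (f := f) i x y).symm
  map_mul' x y := (DirectLimit.mul_def (f := f) i x y).symm
  map_star' x := (DirectLimit.star_def (f := f) i x).symm

variable {G f}

theorem of_f {i j : I} (h : i ≤ j) (x : G i) : of G f j (f i j h x) = of G f i x :=
  DirectLimit.mk_apply (f := f) i j x h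

theorem induction {C : AlgLimit G f → Prop} (ih : ∀ i x, C (of G f i x)) (x : AlgLimit G f) :
    C x := DirectLimit.induction (f := f) (C := C) ih x

theorem induction₂ {C : AlgLimit G f → AlgLimit G f → Prop}
    (ih : ∀ i x y, C (of G f i x) (of G f i y)) (x y : AlgLimit G f) : C x y :=
  DirectLimit.induction₂ (f := f) (C := C) ih x y

variable (f)

/-- The limit seminorm `lim_j ‖f i j x‖ = inf_j ‖f i j x‖` of `x ∈ G i`. -/
def limNorm (i : I) (x : G i) : ℝ := ⨅ j : Set.Ici i, ‖f i j j.2 x‖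

open Classical in
/-- The net `j ↦ ‖f i j x‖`, with value `0` where it is not defined. -/
def net (i : I) (x : G i) (j : I) : ℝ := if h : i ≤ j then ‖f i j h x‖ else 0

theorem net_eq {i j : I} (h : i ≤ j) (x : G i) : net f i x j = ‖f i j h x‖ := dif_pos h

theorem limNorm_le {i j : I} (h : i ≤ j) (x : G i) : limNorm f i x ≤ ‖f i j h x‖ :=
  ciInf_le ⟨0, by rintro _ ⟨j, rfl⟩; exact norm_nonneg _⟩ (⟨j, h⟩ : Set.Ici i)

theorem limNorm_nonneg (i : I) (x : G i) : 0 ≤ limNorm f i x :=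
  Real.iInf_nonneg fun _ => norm_nonneg _

theorem f_f {i j k : I} (h : i ≤ j) (h' : j ≤ k) (x : G i) :
    f j k h' (f i j h x) = f i k (h.trans h') x :=
  DirectedSystem.map_map (f := fun i j h => f i j h) h h' x

theorem tendsto_net (i : I) (x : G i) : Tendsto (net f i x) atTop (𝓝 (limNorm f i x)) := by
  refine tendsto_order.2 ⟨fun a ha => ?_, fun a ha => ?_⟩
  · filter_upwards [eventually_ge_atTop i] with j hj
    rw [net_eq f hj]
    exact ha.trans_le (limNorm_le f hj x)
  · have : Nonempty (Set.Ici i) := ⟨⟨i, le_rfl⟩⟩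
    obtain ⟨⟨j, hj⟩, hj'⟩ := exists_lt_of_ciInf_lt ha
    filter_upwards [eventually_ge_atTop j] with k hk
    have hj2 : i ≤ j := hj
    rw [net_eq f (hj2.trans hk), ← f_f f hj2 hk]
    exact (ContractiveSystem.norm_le _ _ hk _).trans_lt hj'

theorem limNorm_le_of {i : I} {x : G i} {b : ℝ} {g : I → ℝ} (hg : Tendsto g atTop (𝓝 b))
    (h : ∀ j (hj : i ≤ j), ‖f i j hj x‖ ≤ g j) : limNorm f i x ≤ b := by
  refine le_of_tendsto_of_tendsto (tendsto_net f i x) hg ?_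
  filter_upwards [eventually_ge_atTop i] with j hj
  rw [net_eq f hj]
  exact h j hj

theorem limNorm_eq_of {i : I} {x : G i} {b : ℝ} {g : I → ℝ} (hg : Tendsto g atTop (𝓝 b)) {k : I}
    (h : ∀ j (hj : i ≤ j), k ≤ j → ‖f i j hj x‖ = g j) : limNorm f i x = b := by
  refine tendsto_nhds_unique (tendsto_net f i x) (hg.congr' ?_)
  filter_upwards [eventually_ge_atTop i, eventually_ge_atTop k] with j hj hk
  rw [net_eq f hj]
  exact (h j hj hk).symm

theorem limNorm_f {i j : I} (h : i ≤ j) (x : G i) : limNorm f i x = limNorm f j (f i j h x) :=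
  limNorm_eq_of f (tendsto_net f j (f i j h x)) (k := j) fun k hk hjk => by
    rw [net_eq f hjk, f_f]

/-- The limit seminorm on the algebraic direct limit. -/
instance : Norm (AlgLimit G f) where
  norm x := DirectLimit.lift f (fun i x => limNorm f i x) (fun _ _ h x => limNorm_f f h x) x

theorem norm_of (i : I) (x : G i) : ‖of G f i x‖ = limNorm f i x := rfl

theorem norm_star_mul_self (x : AlgLimit G f) : ‖star x * x‖ = ‖x‖ * ‖x‖ := by
  induction x using induction with
  | ih i x =>
    rw [← map_star, ← map_mul, norm_of, norm_of]
    refine limNorm_eq_of f ((tendsto_net f i x).mul (tendsto_net f i x)) (k := i) fun j hj _ => ?_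
    rw [net_eq f hj, map_mul, map_star, CStarRing.norm_star_mul_self]

theorem norm_star' (x : AlgLimit G f) : ‖star x‖ = ‖x‖ := by
  induction x using induction with
  | ih i x =>
    rw [← map_star, norm_of, norm_of]
    refine limNorm_eq_of f (tendsto_net f i x) (k := i) fun j hj _ => ?_
    rw [net_eq f hj, map_star, norm_star]

theorem norm_smul' (c : ℂ) (x : AlgLimit G f) : ‖c • x‖ = ‖c‖ * ‖x‖ := by
  induction x using induction with
  | ih i x =>
    rw [← map_smul, norm_of, norm_of]
    refine limNorm_eq_of f ((tendsto_net f i x).const_mul ‖c‖) (k := i) fun j hj _ => ?_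
    rw [net_eq f hj, map_smul, norm_smul]

instance : SeminormedAddCommGroup (AlgLimit G f) :=
  AddGroupSeminorm.toSeminormedAddCommGroup
    { toFun := fun x => ‖x‖
      map_zero' := by
        have i : I := Classical.arbitrary I
        rw [← map_zero (of G f i), norm_of]
        exact limNorm_eq_of f tendsto_const_nhds (k := i) fun j hj _ => by simp
      add_le' := fun x y => by
        induction x, y using induction₂ with
        | ih i x y =>
          rw [← map_add, norm_of, norm_of, norm_of]
          refine limNorm_le_of f ((tendsto_net f i x).add (tendsto_net f i y)) fun j hj => ?_
          rw [net_eq f hj, net_eq f hj, map_add]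
          exact norm_add_le _ _
      neg' := fun x => by
        have := norm_smul' f (-1) x
        simpa using this }

instance : NonUnitalSeminormedRing (AlgLimit G f) :=
  { (inferInstance : NonUnitalRing (AlgLimit G f)),
    (inferInstance : SeminormedAddCommGroup (AlgLimit G f)) with
    norm_mul_le := fun x y => by
      induction x, y using induction₂ with
      | ih i x y =>
        rw [← map_mul, norm_of, norm_of, norm_of]
        refine limNorm_le_of f ((tendsto_net f i x).mul (tendsto_net f i y)) fun j hj => ?_
        rw [net_eq f hj, net_eq f hj, map_mul]
        exact norm_mul_le _ _ }

instance : NormedSpace ℂ (AlgLimit G f) where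
  norm_smul_le c x := (norm_smul' f c x).le

instance : PreCStarAlgebra (AlgLimit G f) where
  norm_star' := norm_star' f
  norm_star_mul_self := norm_star_mul_self f

end AlgLimit

/-- The inductive limit C*-algebra of the system `(G, f)`: the Hausdorff completion of the
algebraic direct limit with respect to the limit seminorm. -/
abbrev CStarLimit : Type _ := CStarCompletion (AlgLimit G f)

namespace CStarLimit

/-- The canonical *-homomorphism from `G i` to the inductive limit. -/
def of (i : I) : G i →⋆ₙₐ[ℂ] CStarLimit G f where
  toFun x := CStarCompletion.toLim _ (AlgLimit.of G f i x)
  map_smul' c x := by rw [map_smul, map_smul]; rfl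
  map_zero' := by rw [map_zero, map_zero]
  map_add' x y := by rw [map_add, map_add]
  map_mul' x y := by rw [map_mul, CStarCompletion.toLim_mul]
  map_star' x := by rw [map_star, CStarCompletion.toLim_star]

theorem of_f {i j : I} (h : i ≤ j) (x : G i) : of G f j (f i j h x) = of G f i x :=
  congrArg (CStarCompletion.toLim _) (AlgLimit.of_f h x)

end CStarLimit

end CStarLimit
/-- A right Hilbert `A`-module over a (not necessarily unital) C*-algebra `A`: a complex Banach
space with a right `A`-action and an `A`-valued inner product, conjugate-linear in the first and
`A`-linear in the second variable, whose norm is `‖x‖ = ‖⟨x, x⟩‖ ^ (1 / 2)`. The remaining axioms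
of the right action (bilinearity, associativity) follow from `ip_rsmul_right`. -/
class RightHilbertModule (A : Type*) [NonUnitalCStarAlgebra A] (E : Type*)
    [NormedAddCommGroup E] [NormedSpace ℂ E] where
  /-- the inner product `⟨x, y⟩` -/
  ip : E → E → A
  /-- the right action `x a` -/
  rsmul : E → A → E
  ip_add_right : ∀ x y z, ip x (y + z) = ip x y + ip x z
  ip_smul_right : ∀ (c : ℂ) x y, ip x (c • y) = c • ip x y
  ip_rsmul_right : ∀ x y a, ip x (rsmul y a) = ip x y * a
  star_ip : ∀ x y, star (ip x y) = ip y x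
  ip_self_pos : ∀ x, ∃ b, ip x x = star b * b
  norm_sq_eq : ∀ x, ‖x‖ ^ 2 = ‖ip x x‖
  complete : CompleteSpace E

namespace RightHilbertModule

variable {A : Type*} [NonUnitalCStarAlgebra A] {E : Type*} [NormedAddCommGroup E]
  [NormedSpace ℂ E] [RightHilbertModule A E]

theorem ip_rsmul_left (x y : E) (a : A) : ip (rsmul x a) y = star a * ip x y := by
  rw [← star_ip, ip_rsmul_right, star_mul, star_ip]

theorem ip_add_left (x y z : E) : ip (x + y) z = (ip x z + ip y z : A) := by
  rw [← star_ip, ip_add_right, star_add, star_ip, star_ip]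

theorem ip_smul_left (c : ℂ) (x y : E) : ip (c • x) y = (star c • ip x y : A) := by
  rw [← star_ip, ip_smul_right, star_smul, star_ip]

theorem norm_ip_le (x y : E) : ‖(ip x y : A)‖ ≤ ‖x‖ * ‖y‖ := by
  let : PartialOrder Aᵐᵒᵖ := CStarAlgebra.spectralOrder Aᵐᵒᵖ
  have : StarOrderedRing Aᵐᵒᵖ := CStarAlgebra.spectralOrderedRing Aᵐᵒᵖ
  let : SMul Aᵐᵒᵖ E := ⟨fun a x => rsmul x a.unop⟩
  have hz : ∀ x : E, ip x x = (0 : A) ↔ x = 0 := fun x => by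
    rw [← norm_eq_zero, ← norm_sq_eq]; simp
  let : CStarModule Aᵐᵒᵖ E :=
    { inner := fun x y => MulOpposite.op (ip x y)
      inner_add_right := by intro x y z; simp [ip_add_right]
      inner_self_nonneg := by
        intro x
        obtain ⟨b, hb⟩ := ip_self_pos (A := A) x
        rw [hb, MulOpposite.op_mul, MulOpposite.op_star]
        exact mul_star_self_nonneg _
      inner_self := by intro x; simp [hz]
      inner_op_smul_right := by
        intro a x y
        exact congrArg MulOpposite.op (ip_rsmul_right x y a.unop)
      inner_smul_right_complex := by
        intro z x y; exact congrArg MulOpposite.op (ip_smul_right z x y)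
      star_inner := fun x y => congrArg MulOpposite.op (star_ip x y)
      norm_eq_sqrt_norm_inner_self := by
        intro x
        change _ = √‖ip x x‖
        rw [← norm_sq_eq, Real.sqrt_sq (norm_nonneg _)] }
  have := CStarModule.norm_inner_le (A := Aᵐᵒᵖ) E (x := x) (y := y)
  exact this

variable (A E) in
/-- The inner product as a bounded sesquilinear map. -/
noncomputable def ipL : E →L⋆[ℂ] E →L[ℂ] A :=
  LinearMap.mkContinuous₂
    (LinearMap.mk₂'ₛₗ (starRingEnd ℂ) (RingHom.id ℂ) (fun x y => (ip x y : A))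
      (fun x y z => ip_add_left x y z) (fun c x y => ip_smul_left c x y)
      (fun x y z => ip_add_right x y z) (fun c x y => ip_smul_right c x y)) 1
    (fun x y => by simpa using norm_ip_le (A := A) x y)

@[simp] theorem ipL_apply (x y : E) : ipL A E x y = ip x y := rfl

theorem ip_zero_left (y : E) : ip (0 : E) y = (0 : A) := by simp [← ipL_apply]
theorem ip_zero_right (y : E) : ip y (0 : E) = (0 : A) := by simp [← ipL_apply]
theorem ip_sub_right (x y z : E) : ip x (y - z) = (ip x y - ip x z : A) := by simp [← ipL_apply]

variable (A) in
theorem eq_zero_of_ip_self {x : E} (h : ip x x = (0 : A)) : x = 0 := by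
  have := norm_sq_eq (A := A) x
  rw [h] at this
  simpa using this

variable (A) in
theorem ext_ip_left {x y : E} (h : ∀ z : E, ip z x = (ip z y : A)) : x = y := by
  rw [← sub_eq_zero]
  apply eq_zero_of_ip_self A
  rw [ip_sub_right, h, sub_self]

variable (A) in
theorem ext_ip_right {x y : E} (h : ∀ z : E, ip x z = (ip y z : A)) : x = y :=
  ext_ip_left A fun z => by rw [← star_ip, h, star_ip]

variable (A) in
theorem norm_le_of_ip {x : E} {C : ℝ} (hC : 0 ≤ C) (h : ∀ z : E, ‖(ip z x : A)‖ ≤ C * ‖z‖) :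
    ‖x‖ ≤ C := by
  by_cases hx : x = 0
  · simpa [hx] using hC
  · have h1 := h x
    rw [← norm_sq_eq, sq] at h1
    exact le_of_mul_le_mul_right h1 (norm_pos_iff.2 hx)

theorem continuous_ip {α : Type*} [TopologicalSpace α] {f g : α → E} (hf : Continuous f)
    (hg : Continuous g) : Continuous fun t => (ip (f t) (g t) : A) := by
  simp only [← ipL_apply]
  fun_prop

end RightHilbertModule

open RightHilbertModule in
/-- The adjointable operators on a right Hilbert `A`-module `E`, with their adjoints. -/
structure Adjointable (A : Type*) [NonUnitalCStarAlgebra A] (E : Type*) [NormedAddCommGroup E]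
    [NormedSpace ℂ E] [RightHilbertModule A E] where
  /-- the operator -/
  op : E →L[ℂ] E
  /-- its adjoint -/
  adj : E →L[ℂ] E
  ip_adj : ∀ x y, ip (op x) y = (ip x (adj y) : A)

namespace Adjointable

open RightHilbertModule

variable {A : Type*} [NonUnitalCStarAlgebra A] {E : Type*} [NormedAddCommGroup E]
  [NormedSpace ℂ E] [RightHilbertModule A E]

theorem ip_adj' (T : Adjointable A E) (x y : E) : ip (T.adj x) y = (ip x (T.op y) : A) := by
  rw [← star_ip, ← T.ip_adj, star_ip]

theorem op_injective : Function.Injective (op : Adjointable A E → (E →L[ℂ] E)) := by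
  rintro ⟨S, S', hS⟩ ⟨T, T', hT⟩ (rfl : S = T)
  congr
  ext y
  exact ext_ip_left A fun z => by rw [← hS, ← hT]

theorem ext' {S T : Adjointable A E} (h : ∀ x, S.op x = T.op x) : S = T :=
  op_injective (ContinuousLinearMap.ext h)

instance : Zero (Adjointable A E) := ⟨⟨0, 0, fun x y => by simp [ip_zero_left, ip_zero_right]⟩⟩
instance : Add (Adjointable A E) :=
  ⟨fun S T => ⟨S.op + T.op, S.adj + T.adj, fun x y => by
    simp [ip_add_left, ip_add_right, S.ip_adj, T.ip_adj]⟩⟩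
instance : Mul (Adjointable A E) :=
  ⟨fun S T => ⟨S.op * T.op, T.adj * S.adj, fun x y => by simp [S.ip_adj, T.ip_adj]⟩⟩
instance : SMul ℂ (Adjointable A E) :=
  ⟨fun c T => ⟨c • T.op, star c • T.adj, fun x y => by
    simp only [smul_apply, ip_smul_left, ip_smul_right, T.ip_adj]⟩⟩
instance : Neg (Adjointable A E) :=
  ⟨fun T => ⟨-T.op, -T.adj, fun x y => by
    simp only [neg_apply, ← ipL_apply, map_neg]
    simp [T.ip_adj]⟩⟩
instance : Sub (Adjointable A E) :=
  ⟨fun S T => ⟨S.op - T.op, S.adj - T.adj, fun x y => by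
    simp only [sub_apply, ← ipL_apply, map_sub]
    simp [T.ip_adj, S.ip_adj]⟩⟩
instance : SMul ℕ (Adjointable A E) :=
  ⟨fun c T => ⟨c • T.op, c • T.adj, fun x y => by
    simp only [smul_apply, ← ipL_apply, map_nsmul]
    simp [T.ip_adj]⟩⟩
instance : SMul ℤ (Adjointable A E) :=
  ⟨fun c T => ⟨c • T.op, c • T.adj, fun x y => by
    simp only [smul_apply, ← ipL_apply, map_zsmul]
    simp [T.ip_adj]⟩⟩
instance : Star (Adjointable A E) := ⟨fun T => ⟨T.adj, T.op, T.ip_adj'⟩⟩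

@[simp] theorem zero_op : (0 : Adjointable A E).op = 0 := rfl
@[simp] theorem add_op (S T : Adjointable A E) : (S + T).op = S.op + T.op := rfl
@[simp] theorem sub_op (S T : Adjointable A E) : (S - T).op = S.op - T.op := rfl
@[simp] theorem mul_op (S T : Adjointable A E) : (S * T).op = S.op * T.op := rfl
@[simp] theorem smul_op (c : ℂ) (T : Adjointable A E) : (c • T).op = c • T.op := rfl
@[simp] theorem star_op (T : Adjointable A E) : (star T).op = T.adj := rfl
@[simp] theorem star_adj (T : Adjointable A E) : (star T).adj = T.op := rfl

instance : NonUnitalRing (Adjointable A E) :=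
  op_injective.nonUnitalRing _ rfl (fun _ _ => rfl) (fun _ _ => rfl) (fun _ => rfl)
    (fun _ _ => rfl) (fun _ _ => rfl) (fun _ _ => rfl)

/-- `T ↦ T.op` as a ring homomorphism. -/
def opHom : Adjointable A E →ₙ+* (E →L[ℂ] E) where
  toFun := op
  map_zero' := rfl
  map_add' _ _ := rfl
  map_mul' _ _ := rfl

/-- The norm of an adjointable operator is its operator norm. -/
noncomputable instance : NonUnitalNormedRing (Adjointable A E) :=
  NonUnitalNormedRing.induced _ _ opHom op_injective

theorem norm_def (T : Adjointable A E) : ‖T‖ = ‖T.op‖ := rfl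

instance : Module ℂ (Adjointable A E) :=
  Function.Injective.module ℂ (opHom : Adjointable A E →ₙ+* (E →L[ℂ] E)).toAddMonoidHom
    op_injective (fun _ _ => rfl)

noncomputable instance : NormedSpace ℂ (Adjointable A E) where
  norm_smul_le c T := norm_smul_le c T.op

instance : IsScalarTower ℂ (Adjointable A E) (Adjointable A E) :=
  ⟨fun c S T => op_injective (smul_mul_assoc c S.op T.op)⟩

instance : SMulCommClass ℂ (Adjointable A E) (Adjointable A E) :=
  ⟨fun c S T => op_injective (mul_smul_comm c S.op T.op).symm⟩

instance : StarRing (Adjointable A E) where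
  star_involutive _ := rfl
  star_mul _ _ := rfl
  star_add _ _ := rfl

instance : StarModule ℂ (Adjointable A E) where
  star_smul _ _ := op_injective rfl

theorem norm_op_sq_le (T : Adjointable A E) (x : E) :
    ‖T.op x‖ ^ 2 ≤ ‖star T * T‖ * ‖x‖ ^ 2 := by
  rw [norm_sq_eq (A := A), T.ip_adj]
  calc ‖(ip x (T.adj (T.op x)) : A)‖ ≤ ‖x‖ * ‖T.adj (T.op x)‖ := norm_ip_le _ _
    _ ≤ ‖x‖ * (‖star T * T‖ * ‖x‖) := by
        gcongr
        exact (star T * T).op.le_opNorm x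
    _ = _ := by ring

noncomputable instance : CStarRing (Adjointable A E) where
  norm_mul_self_le T := by
    have h : ‖T‖ ≤ √‖star T * T‖ := by
      refine T.op.opNorm_le_bound (Real.sqrt_nonneg _) fun x => ?_
      rw [← Real.sqrt_sq (norm_nonneg x), ← Real.sqrt_mul (norm_nonneg _)]
      exact Real.le_sqrt_of_sq_le (T.norm_op_sq_le x)
    calc ‖T‖ * ‖T‖ ≤ √‖star T * T‖ * √‖star T * T‖ := by gcongr
      _ = _ := Real.mul_self_sqrt (norm_nonneg _)

theorem norm_adj (T : Adjointable A E) : ‖T.adj‖ = ‖T.op‖ := by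
  have := CStarRing.norm_star_mul_self (x := T)
  exact norm_star T

instance : CompleteSpace (Adjointable A E) := by
  have : CompleteSpace E := RightHilbertModule.complete A
  refine Metric.complete_of_cauchySeq_tendsto fun u hu => ?_
  have i1 : Isometry (op : Adjointable A E → (E →L[ℂ] E)) :=
    Isometry.of_dist_eq fun S T => by rw [dist_eq_norm, dist_eq_norm]; rfl
  have i2 : Isometry (adj : Adjointable A E → (E →L[ℂ] E)) :=
    Isometry.of_dist_eq fun S T => by
      rw [dist_eq_norm, dist_eq_norm, norm_def, ← norm_adj]; rfl
  obtain ⟨S, hS⟩ := cauchySeq_tendsto_of_complete (i1.uniformContinuous.comp_cauchySeq hu)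
  obtain ⟨S', hS'⟩ := cauchySeq_tendsto_of_complete (i2.uniformContinuous.comp_cauchySeq hu)
  refine ⟨⟨S, S', fun x y => ?_⟩, i1.isEmbedding.tendsto_nhds_iff.2 hS⟩
  have t1 : Filter.Tendsto (fun n => ((u n).op x : E)) Filter.atTop (nhds (S x)) :=
    ((ContinuousLinearMap.apply ℂ E x).continuous.tendsto S).comp hS
  have t2 : Filter.Tendsto (fun n => ((u n).adj y : E)) Filter.atTop (nhds (S' y)) :=
    ((ContinuousLinearMap.apply ℂ E y).continuous.tendsto S').comp hS'
  have c1 : Continuous fun z : E => (ip z y : A) := continuous_ip continuous_id continuous_const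
  have c2 : Continuous fun z : E => (ip x z : A) := continuous_ip continuous_const continuous_id
  refine tendsto_nhds_unique ((c1.tendsto _).comp t1) ?_
  refine ((c2.tendsto _).comp t2).congr fun n => ?_
  exact ((u n).ip_adj x y).symm

noncomputable instance : NonUnitalCStarAlgebra (Adjointable A E) where

end Adjointable

namespace RightHilbertModule

variable {A : Type*} [NonUnitalCStarAlgebra A] {E : Type*} [NormedAddCommGroup E]
  [NormedSpace ℂ E] [RightHilbertModule A E]

theorem norm_rsmul_le (x : E) (a : A) : ‖rsmul x a‖ ≤ ‖x‖ * ‖a‖ := by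
  refine norm_le_of_ip A (by positivity) fun z => ?_
  rw [ip_rsmul_right]
  calc ‖ip z x * a‖ ≤ ‖ip z x‖ * ‖a‖ := norm_mul_le _ _
    _ ≤ ‖z‖ * ‖x‖ * ‖a‖ := by gcongr; exact norm_ip_le _ _
    _ = _ := by ring

theorem rsmul_add (x : E) (a b : A) : rsmul x (a + b) = rsmul x a + rsmul x b :=
  ext_ip_left A fun z => by simp only [ip_rsmul_right, ip_add_right, mul_add]

theorem rsmul_smul (c : ℂ) (x : E) (a : A) : rsmul x (c • a) = c • rsmul x a :=
  ext_ip_left A fun z => by simp only [ip_rsmul_right, ip_smul_right, mul_smul_comm]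

/-- The right action on a fixed vector as a bounded linear map. -/
noncomputable def rsmulL (x : E) : A →L[ℂ] E :=
  LinearMap.mkContinuous
    { toFun := fun a => rsmul x a
      map_add' := rsmul_add x
      map_smul' := fun c a => rsmul_smul c x a } ‖x‖ (norm_rsmul_le x)

end RightHilbertModule

namespace Adjointable

open RightHilbertModule

variable {A : Type*} [NonUnitalCStarAlgebra A] {E : Type*} [NormedAddCommGroup E]
  [NormedSpace ℂ E] [RightHilbertModule A E]

variable (A) in
/-- The rank-one operator `θ_{ξ, η}`, given by `ζ ↦ ξ ⟨η, ζ⟩`. -/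
noncomputable def rankOne (ξ η : E) : Adjointable A E where
  op := (rsmulL ξ).comp (ipL A E η)
  adj := (rsmulL η).comp (ipL A E ξ)
  ip_adj x y := by
    change ip (rsmul ξ (ip η x : A)) y = (ip x (rsmul η (ip ξ y : A)) : A)
    rw [ip_rsmul_left, ip_rsmul_right, star_ip]

@[simp] theorem rankOne_op (ξ η ζ : E) : (rankOne A ξ η).op ζ = rsmul ξ (ip η ζ : A) := rfl

theorem star_rankOne (ξ η : E) : star (rankOne A ξ η) = rankOne A η ξ := rfl

theorem op_rsmul (T : Adjointable A E) (x : E) (a : A) : T.op (rsmul x a) = rsmul (T.op x) a :=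
  ext_ip_left A fun z => by
    rw [← star_star T, star_op, ← ip_adj, ip_rsmul_right, ip_rsmul_right, ip_adj]

theorem mul_rankOne (T : Adjointable A E) (ξ η : E) :
    T * rankOne A ξ η = rankOne A (T.op ξ) η :=
  ext' fun x => T.op_rsmul ξ (ip η x)

variable (A E) in
/-- The compact operators `𝓚(E)`: the closed linear span of the rank-one operators. -/
noncomputable def compacts : Submodule ℂ (Adjointable A E) :=
  (Submodule.span ℂ {T | ∃ ξ η : E, T = rankOne A ξ η}).topologicalClosure

theorem rankOne_mem (ξ η : E) : rankOne A ξ η ∈ compacts A E :=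
  Submodule.le_topologicalClosure _ (Submodule.subset_span ⟨ξ, η, rfl⟩)

theorem compacts_induction {p : Adjointable A E → Prop} (hc : IsClosed {T | p T})
    (h0 : p 0) (hadd : ∀ S T, p S → p T → p (S + T)) (hsmul : ∀ (c : ℂ) T, p T → p (c • T))
    (h1 : ∀ ξ η, p (rankOne A ξ η)) {T : Adjointable A E} (hT : T ∈ compacts A E) : p T := by
  refine closure_minimal ?_ hc hT
  intro S hS
  induction hS using Submodule.span_induction with
  | mem x hx => obtain ⟨ξ, η, rfl⟩ := hx; exact h1 ξ η
  | zero => exact h0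
  | add x y _ _ hx hy => exact hadd _ _ hx hy
  | smul c x _ hx => exact hsmul c _ hx

theorem isClosed_compacts : IsClosed (compacts A E : Set (Adjointable A E)) :=
  Submodule.isClosed_topologicalClosure _

theorem star_mem_compacts {T : Adjointable A E} (hT : T ∈ compacts A E) :
    star T ∈ compacts A E := by
  refine compacts_induction (p := fun T => star T ∈ compacts A E)
    (isClosed_compacts.preimage continuous_star) (by simp) ?_ ?_ ?_ hT
  · intro S T hS hT; rw [star_add]; exact add_mem hS hT
  · intro c T hT; rw [star_smul]; exact Submodule.smul_mem _ _ hT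
  · intro ξ η; exact rankOne_mem η ξ

/-- The operator that an adjointable operator `T` induces on an invariant closed submodule `F`
(for the Hilbert module structure of `F` that is inherited from `E`). -/
noncomputable def restrict (F : Submodule ℂ E) [RightHilbertModule A F]
    (hF : ∀ x y : F, (ip x y : A) = ip (x : E) (y : E))
    (hinv : ∀ (T : Adjointable A E), ∀ x ∈ F, T.op x ∈ F) (T : Adjointable A E) :
    Adjointable A F where
  op := (T.op.comp F.subtypeL).codRestrict F fun x => hinv T x x.2
  adj := (T.adj.comp F.subtypeL).codRestrict F fun x => hinv (star T) x x.2
  ip_adj x y := by rw [hF, hF]; exact T.ip_adj x y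

end Adjointable

/-- An elementary estimate: if `b k ^ 2 ≤ x * b (k + 1)` and `b k` grows at most like
`r ^ (2 ^ k)`, then `b 0 ≤ r * x`. -/
theorem le_of_sq_le_of_growth {b : ℕ → ℝ} {x C r : ℝ} (hx : 0 ≤ x) (hr : 0 ≤ r)
    (hb : ∀ k, 0 ≤ b k) (h1 : ∀ k, b k ^ 2 ≤ x * b (k + 1)) (h2 : ∀ k, b k ≤ C * r ^ (2 ^ k)) :
    b 0 ≤ r * x := by
  rcases hx.eq_or_lt with rfl | hx
  · have := h1 0
    have h3 : b 0 = 0 := by nlinarith [hb 0]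
    simp [h3]
  have h3 : ∀ k, (b 0 / x) ^ (2 ^ k) ≤ b k / x := by
    intro k
    induction k with
    | zero => simp
    | succ k ih =>
      calc (b 0 / x) ^ (2 ^ (k + 1)) = ((b 0 / x) ^ (2 ^ k)) ^ 2 := by rw [pow_succ, pow_mul]
        _ ≤ (b k / x) ^ 2 := by
            have : 0 ≤ (b 0 / x) ^ (2 ^ k) := pow_nonneg (div_nonneg (hb 0) hx.le) _
            gcongr
        _ ≤ b (k + 1) / x := by
            rw [div_pow, div_le_div_iff₀ (by positivity) hx]
            nlinarith [h1 k]
  rw [← div_le_iff₀ hx]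
  by_contra hlt
  push Not at hlt
  rcases hr.eq_or_lt with rfl | hr
  · have h4 := (h2 0)
    simp at h4
    have : b 0 = 0 := le_antisymm h4 (hb 0)
    simp [this] at hlt
  have h5 : 1 < b 0 / x / r := by rwa [lt_div_iff₀ hr, one_mul]
  obtain ⟨k, hk⟩ := pow_unbounded_of_one_lt (C / x) h5
  have h6 : (b 0 / x / r) ^ k ≤ (b 0 / x / r) ^ (2 ^ k) :=
    pow_le_pow_right₀ h5.le (Nat.lt_two_pow_self).le
  have h7 : (b 0 / x / r) ^ (2 ^ k) ≤ C / x := by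
    rw [div_pow, div_le_iff₀ (by positivity)]
    calc _ ≤ b k / x := h3 k
      _ ≤ C * r ^ (2 ^ k) / x := by gcongr; exact h2 k
      _ = _ := by ring
  linarith

open RightHilbertModule Adjointable

/-- A product system over `ℕ^{⊕ ι}` of Hilbert `A`-bimodules. The fibre over `n` is `fib n`; the
semigroup multiplication of the disjoint union of the fibres is given by its restrictions
`X_m × X_n → X_l`, one for each proof of `m + n = l`. The identity fibre is identified with `A`
by `unit`. The last two fields say that the map `ξ ⊗ η ↦ ξ η` from the algebraic tensor
product `X_m ⊗ X_n` to `X_{m + n}` preserves the inner product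
`⟨ξ ⊗ η, ξ' ⊗ η'⟩ = ⟨η, ⟨ξ, ξ'⟩ η'⟩` and has dense range, that is, it extends to an
isomorphism from the balanced tensor product `X_m ⊗_A X_n` (the Hausdorff completion of the
algebraic one for this inner product) onto `X_{m + n}`. It respects both actions of `A` by
associativity. -/
structure ProductSystem (ι : Type*) (A : Type*) [NonUnitalCStarAlgebra A] where
  /-- the fibres -/
  fib : (ι →₀ ℕ) → Type*
  [normed : ∀ n, NormedAddCommGroup (fib n)]
  [space : ∀ n, NormedSpace ℂ (fib n)]
  [hilbert : ∀ n, RightHilbertModule A (fib n)]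
  /-- the left action `φ_n` -/
  lact : ∀ n, A →⋆ₙₐ[ℂ] Adjointable A (fib n)
  /-- the multiplication -/
  mul : ∀ {m n l : ι →₀ ℕ}, m + n = l → fib m →ₗ[ℂ] fib n →ₗ[ℂ] fib l
  mul_mul : ∀ {m n p s t l : ι →₀ ℕ} (h₁ : m + n = s) (h₂ : s + p = l) (h₃ : n + p = t)
    (h₄ : m + t = l) (ξ : fib m) (η : fib n) (ζ : fib p),
    mul h₂ (mul h₁ ξ η) ζ = mul h₄ ξ (mul h₃ η ζ)
  /-- the identification of `A` with the identity fibre -/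
  unit : A ≃ₗ[ℂ] fib 0
  ip_unit : ∀ a b, ip (unit a) (unit b) = star a * b
  rsmul_unit : ∀ a b, rsmul (unit a) b = unit (a * b)
  lact_unit : ∀ a b, (lact 0 a).op (unit b) = unit (a * b)
  unit_mul : ∀ {n : ι →₀ ℕ} (h : 0 + n = n) (a : A) (ξ : fib n),
    mul h (unit a) ξ = (lact n a).op ξ
  mul_unit : ∀ {n : ι →₀ ℕ} (h : n + 0 = n) (ξ : fib n) (a : A),
    mul h ξ (unit a) = rsmul ξ a
  ip_mul : ∀ {m n l : ι →₀ ℕ} (h : m + n = l), m ≠ 0 → n ≠ 0 →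
    ∀ (ξ ξ' : fib m) (η η' : fib n),
      ip (mul h ξ η) (mul h ξ' η') = (ip η ((lact n (ip ξ ξ')).op η') : A)
  dense_mul : ∀ {m n l : ι →₀ ℕ} (h : m + n = l), m ≠ 0 → n ≠ 0 →
    (Submodule.span ℂ {ζ | ∃ ξ η, ζ = mul h ξ η}).topologicalClosure = ⊤

attribute [instance] ProductSystem.normed ProductSystem.space ProductSystem.hilbert

namespace ProductSystem

variable {ι : Type*} {A : Type*} [NonUnitalCStarAlgebra A] (X : ProductSystem ι A)

theorem unit_surj (x : X.fib 0) : ∃ a, X.unit a = x := X.unit.surjective x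

theorem ip_mul' {m n l : ι →₀ ℕ} (h : m + n = l) (ξ ξ' : X.fib m) (η η' : X.fib n) :
    ip (X.mul h ξ η) (X.mul h ξ' η') = (ip η ((X.lact n (ip ξ ξ')).op η') : A) := by
  by_cases hm : m = 0
  · subst hm
    obtain rfl : n = l := by simpa using h
    obtain ⟨a, rfl⟩ := X.unit_surj ξ
    obtain ⟨b, rfl⟩ := X.unit_surj ξ'
    rw [X.unit_mul, X.unit_mul, X.ip_unit, Adjointable.ip_adj, map_mul, map_star]
    rfl
  by_cases hn : n = 0
  · subst hn
    obtain rfl : m = l := by simpa using h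
    obtain ⟨a, rfl⟩ := X.unit_surj η
    obtain ⟨b, rfl⟩ := X.unit_surj η'
    rw [X.mul_unit, X.mul_unit, X.lact_unit, X.ip_unit, ip_rsmul_left, ip_rsmul_right]
  exact X.ip_mul h hm hn _ _ _ _

/-- The ideal `I_n = ⋂_{0 < m ≤ n} ker φ_m` of `A`, which is `A` for `n = 0`. -/
def ideal (n : ι →₀ ℕ) : Submodule ℂ A where
  carrier := {a | ∀ m, 0 < m → m ≤ n → X.lact m a = 0}
  add_mem' := fun ha hb m h0 hm => by rw [map_add, ha m h0 hm, hb m h0 hm, add_zero]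
  zero_mem' := fun m _ _ => map_zero _
  smul_mem' := fun c a ha m h0 hm => by rw [map_smul, ha m h0 hm, smul_zero]

theorem isClosed_ideal (n : ι →₀ ℕ) : IsClosed (X.ideal n : Set A) := by
  have : (X.ideal n : Set A) = ⋂ m, ⋂ (_ : 0 < m), ⋂ (_ : m ≤ n), {a | X.lact m a = 0} := by
    ext a; simp [ideal]
  rw [this]
  refine isClosed_iInter fun m => isClosed_iInter fun _ => isClosed_iInter fun _ => ?_
  exact isClosed_eq (AddMonoidHomClass.continuous_of_bound (X.lact m) 1 fun a => by
    simpa using NonUnitalStarAlgHom.norm_apply_le (X.lact m) a) continuous_const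

theorem mul_eq_zero_of_mem {q n m l : ι →₀ ℕ} {ξ : X.fib q} (hξ : (ip ξ ξ : A) ∈ X.ideal n)
    (h0 : 0 < m) (hm : m ≤ n) (h : q + m = l) (η : X.fib m) : X.mul h ξ η = 0 := by
  apply eq_zero_of_ip_self A
  rw [X.ip_mul', hξ m h0 hm, zero_op]
  simp [ip_zero_right]

theorem ip_mem_ideal {q n : ι →₀ ℕ} {ξ : X.fib q} (hξ : (ip ξ ξ : A) ∈ X.ideal n)
    (ζ : X.fib q) : (ip ζ ξ : A) ∈ X.ideal n := by
  intro m h0 hm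
  refine ext' fun η => ext_ip_left A fun η' => ?_
  rw [← X.ip_mul' rfl, X.mul_eq_zero_of_mem hξ h0 hm]
  simp [ip_zero_right]

theorem mul_mem_ideal {n : ι →₀ ℕ} {a : A} (ha : a ∈ X.ideal n) (b : A) :
    b * a ∈ X.ideal n ∧ a * b ∈ X.ideal n :=
  ⟨fun m h0 hm => by rw [map_mul, ha m h0 hm, mul_zero],
    fun m h0 hm => by rw [map_mul, ha m h0 hm, zero_mul]⟩

/-- The submodule `X_q I_n = {ξ ∈ X_q | ⟨ξ, ξ⟩ ∈ I_n}`. -/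
def fibIdeal (q n : ι →₀ ℕ) : Submodule ℂ (X.fib q) where
  carrier := {ξ | (ip ξ ξ : A) ∈ X.ideal n}
  add_mem' := fun {ξ η} hξ hη => by
    change (ip (ξ + η) (ξ + η) : A) ∈ X.ideal n
    rw [ip_add_right]
    exact add_mem (X.ip_mem_ideal hξ _) (X.ip_mem_ideal hη _)
  zero_mem' := by
    change (ip (0 : X.fib q) 0 : A) ∈ X.ideal n
    rw [ip_zero_left]; exact zero_mem _
  smul_mem' := fun c ξ hξ => by
    change (ip (c • ξ) (c • ξ) : A) ∈ X.ideal n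
    rw [ip_smul_right]
    exact Submodule.smul_mem _ _ (X.ip_mem_ideal hξ _)

theorem isClosed_fibIdeal (q n : ι →₀ ℕ) : IsClosed (X.fibIdeal q n : Set (X.fib q)) :=
  (X.isClosed_ideal n).preimage (continuous_ip continuous_id continuous_id)

/-- `X_q I_n` is a right Hilbert `A`-module. -/
instance (q n : ι →₀ ℕ) : RightHilbertModule A (X.fibIdeal q n) where
  ip x y := ip (x : X.fib q) (y : X.fib q)
  rsmul x a := ⟨rsmul (x : X.fib q) a, by
    change (ip (rsmul (x : X.fib q) a) (rsmul (x : X.fib q) a) : A) ∈ X.ideal n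
    rw [ip_rsmul_right]
    exact (X.mul_mem_ideal (X.ip_mem_ideal x.2 _) a).2⟩
  ip_add_right x y z := ip_add_right (x : X.fib q) y z
  ip_smul_right c x y := ip_smul_right c (x : X.fib q) y
  ip_rsmul_right x y a := ip_rsmul_right (x : X.fib q) y a
  star_ip x y := star_ip (x : X.fib q) y
  ip_self_pos x := ip_self_pos (x : X.fib q)
  norm_sq_eq x := norm_sq_eq (x : X.fib q)
  complete := by
    have : CompleteSpace (X.fib q) := RightHilbertModule.complete A
    exact (X.isClosed_fibIdeal q n).completeSpace_coe

theorem op_mem_fibIdeal {q n : ι →₀ ℕ} (T : Adjointable A (X.fib q)) (ξ : X.fib q)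
    (hξ : ξ ∈ X.fibIdeal q n) : T.op ξ ∈ X.fibIdeal q n := by
  change (ip (T.op ξ) (T.op ξ) : A) ∈ X.ideal n
  rw [← ip_adj']
  exact X.ip_mem_ideal hξ _

/-- The restriction `T|_{X_q I_n} ∈ 𝓛(X_q I_n)` of `T ∈ 𝓛(X_q)`. -/
noncomputable def restr {q : ι →₀ ℕ} (n : ι →₀ ℕ) (T : Adjointable A (X.fib q)) :
    Adjointable A (X.fibIdeal q n) :=
  restrict (X.fibIdeal q n) (fun _ _ => rfl) (fun T x hx => X.op_mem_fibIdeal T x hx) T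

/-- The multiplication `X_m ⊗ X_n → X_l` on the algebraic tensor product. -/
noncomputable def mulT {m n l : ι →₀ ℕ} (h : m + n = l) :
    TensorProduct ℂ (X.fib m) (X.fib n) →ₗ[ℂ] X.fib l :=
  TensorProduct.lift (X.mul h)

/-- The operator `S ⊗ 1` on the algebraic tensor product, followed by the multiplication. -/
noncomputable def mulS {m n l : ι →₀ ℕ} (h : m + n = l) (S : X.fib m →L[ℂ] X.fib m) :
    TensorProduct ℂ (X.fib m) (X.fib n) →ₗ[ℂ] X.fib l :=
  X.mulT h ∘ₗ LinearMap.rTensor (X.fib n) S.toLinearMap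

theorem mulT_tmul {m n l : ι →₀ ℕ} (h : m + n = l) (ξ : X.fib m) (η : X.fib n) :
    X.mulT h (ξ ⊗ₜ η) = X.mul h ξ η := by simp [mulT]

theorem mulS_tmul {m n l : ι →₀ ℕ} (h : m + n = l) (S : X.fib m →L[ℂ] X.fib m) (ξ : X.fib m)
    (η : X.fib n) : X.mulS h S (ξ ⊗ₜ η) = X.mul h (S ξ) η := by simp [mulS, mulT]

theorem denseRange_mulT {m n l : ι →₀ ℕ} (h : m + n = l) (hm : m ≠ 0) (hn : n ≠ 0) :
    DenseRange (X.mulT h) := by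
  have h1 : Submodule.span ℂ {ζ | ∃ ξ η, ζ = X.mul h ξ η} ≤ LinearMap.range (X.mulT h) := by
    rw [Submodule.span_le]
    rintro _ ⟨ξ, η, rfl⟩
    exact ⟨ξ ⊗ₜ η, X.mulT_tmul h ξ η⟩
  have h2 := Submodule.topologicalClosure_mono h1
  rw [X.dense_mul h hm hn, top_le_iff, ← Submodule.dense_iff_topologicalClosure_eq_top] at h2
  simpa using! h2

theorem ip_mulS {m n l : ι →₀ ℕ} (h : m + n = l) (S : Adjointable A (X.fib m))
    (s t : TensorProduct ℂ (X.fib m) (X.fib n)) :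
    (ip (X.mulS h S.op s) (X.mulT h t) : A) = ip (X.mulT h s) (X.mulS h S.adj t) := by
  induction s with
  | zero => simp [ip_zero_left]
  | add s s' hs hs' => simp only [map_add, ip_add_left, hs, hs']
  | tmul ξ η =>
    induction t with
    | zero => simp [ip_zero_right]
    | add t t' ht ht' => simp only [map_add, ip_add_right, ht, ht']
    | tmul ξ' η' => rw [mulS_tmul, mulS_tmul, mulT_tmul, mulT_tmul, ip_mul', ip_mul', S.ip_adj]

theorem mulS_mul {m n l : ι →₀ ℕ} (h : m + n = l) (S T : X.fib m →L[ℂ] X.fib m)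
    (t : TensorProduct ℂ (X.fib m) (X.fib n)) :
    X.mulS h (S * T) t = X.mulS h S (LinearMap.rTensor (X.fib n) T.toLinearMap t) := by
  induction t with
  | zero => simp
  | add s s' hs hs' => simp only [map_add, hs, hs']
  | tmul ξ η => simp [mulS_tmul]

theorem norm_mul_le {m n l : ι →₀ ℕ} (h : m + n = l) (ξ : X.fib m) (η : X.fib n) :
    ‖X.mul h ξ η‖ ≤ ‖ξ‖ * ‖η‖ := by
  refine abs_le_of_sq_le_sq' ?_ (by positivity) |>.2
  rw [norm_sq_eq (A := A), ip_mul']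
  calc ‖(ip η ((X.lact n (ip ξ ξ)).op η) : A)‖
      ≤ ‖η‖ * ‖(X.lact n (ip ξ ξ)).op η‖ := norm_ip_le _ _
    _ ≤ ‖η‖ * (‖X.lact n (ip ξ ξ)‖ * ‖η‖) := by
        gcongr; exact ContinuousLinearMap.le_opNorm _ _
    _ ≤ ‖η‖ * (‖(ip ξ ξ : A)‖ * ‖η‖) := by
        gcongr; exact NonUnitalStarAlgHom.norm_apply_le _ _
    _ = (‖ξ‖ * ‖η‖) ^ 2 := by rw [← norm_sq_eq]; ring

theorem continuous_mul_left {m n l : ι →₀ ℕ} (h : m + n = l) (η : X.fib n) :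
    Continuous fun ξ : X.fib m => X.mul h ξ η :=
  AddMonoidHomClass.continuous_of_bound ((X.mul h).flip η) ‖η‖ fun ξ => by
    rw [mul_comm]; exact X.norm_mul_le h ξ η

theorem exists_bound_mulS {m n l : ι →₀ ℕ} (h : m + n = l)
    (t : TensorProduct ℂ (X.fib m) (X.fib n)) :
    ∃ C : ℝ, ∀ S : X.fib m →L[ℂ] X.fib m, ‖X.mulS h S t‖ ≤ C * ‖S‖ := by
  induction t with
  | zero => exact ⟨0, fun S => by simp⟩
  | add s s' hs hs' =>
    obtain ⟨C, hC⟩ := hs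
    obtain ⟨C', hC'⟩ := hs'
    refine ⟨C + C', fun S => ?_⟩
    rw [map_add, add_mul]
    exact (norm_add_le _ _).trans (add_le_add (hC S) (hC' S))
  | tmul ξ η =>
    refine ⟨‖ξ‖ * ‖η‖, fun S => ?_⟩
    rw [mulS_tmul]
    calc _ ≤ ‖S ξ‖ * ‖η‖ := X.norm_mul_le h _ _
      _ ≤ ‖S‖ * ‖ξ‖ * ‖η‖ := by gcongr; exact S.le_opNorm ξ
      _ = _ := by ring

theorem norm_mulS_le {m n l : ι →₀ ℕ} (h : m + n = l) (S : Adjointable A (X.fib m))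
    (t : TensorProduct ℂ (X.fib m) (X.fib n)) :
    ‖X.mulS h S.op t‖ ≤ ‖S‖ * ‖X.mulT h t‖ := by
  -- the iterated squares of `S* S`
  let R : ℕ → Adjointable A (X.fib m) := fun k => Nat.rec (star S * S) (fun _ T => T * T) k
  have hR : ∀ k, star (R k) = R k := by
    intro k
    induction k with
    | zero => simp [R]
    | succ k ih => change star (R k * R k) = R k * R k; rw [star_mul, ih]
  have hRn : ∀ k, ‖R k‖ = (‖S‖ ^ 2) ^ (2 ^ k) := by
    intro k
    induction k with
    | zero => simp [R, CStarRing.norm_star_mul_self, sq]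
    | succ k ih =>
      change ‖R k * R k‖ = _
      have := CStarRing.norm_star_mul_self (x := R k)
      rw [hR] at this
      rw [this, ih]; ring
  obtain ⟨C, hC⟩ := X.exists_bound_mulS h t
  have key : ∀ T : Adjointable A (X.fib m),
      ‖X.mulS h T.op t‖ ^ 2 ≤ ‖X.mulT h t‖ * ‖X.mulS h (star T * T).op t‖ := by
    intro T
    rw [norm_sq_eq (A := A)]
    have h2 : (ip (X.mulS h T.op t) (X.mulS h T.op t) : A) =
        ip (X.mulT h t) (X.mulS h (star T * T).op t) := by
      rw [mul_op, mulS_mul]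
      exact X.ip_mulS h T t _
    rw [h2]
    exact norm_ip_le _ _
  have main := le_of_sq_le_of_growth (b := fun k => ‖X.mulS h (R k).op t‖)
    (x := ‖X.mulT h t‖) (r := ‖S‖ ^ 2) (C := C) (norm_nonneg _) (by positivity)
    (fun k => norm_nonneg _) (fun k => ?_) (fun k => ?_)
  · have h3 : ‖X.mulS h S.op t‖ ^ 2 ≤ (‖S‖ * ‖X.mulT h t‖) ^ 2 := by
      calc _ ≤ ‖X.mulT h t‖ * ‖X.mulS h (star S * S).op t‖ := key S
        _ ≤ ‖X.mulT h t‖ * (‖S‖ ^ 2 * ‖X.mulT h t‖) := by gcongr; exact main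
        _ = _ := by ring
    exact abs_le_of_sq_le_sq' h3 (by positivity) |>.2
  · have := key (R k)
    rw [hR] at this
    exact this
  · rw [← hRn]; exact hC _

/-- The operator `M_{m,n} (S ⊗ 1) M_{m,n}⁻¹` on `X_l`, where `l = m + n` and `m, n ≠ 0`. -/
noncomputable def tensorOp {m n l : ι →₀ ℕ} (h : m + n = l) (hm : m ≠ 0) (hn : n ≠ 0)
    (S : Adjointable A (X.fib m)) : Adjointable A (X.fib l) :=
  have : CompleteSpace (X.fib l) := RightHilbertModule.complete A
  { op := (X.mulS h S.op).extendOfNorm (X.mulT h)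
    adj := (X.mulS h S.adj).extendOfNorm (X.mulT h)
    ip_adj := by
      have e1 := LinearMap.extendOfNorm_eq (f := X.mulS h S.op) (X.denseRange_mulT h hm hn)
        ⟨_, X.norm_mulS_le h S⟩
      have e2 := LinearMap.extendOfNorm_eq (f := X.mulS h S.adj) (X.denseRange_mulT h hm hn)
        ⟨_, X.norm_mulS_le h (star S)⟩
      intro x y
      refine (X.denseRange_mulT h hm hn).induction_on₂
        (p := fun x y => (ip ((X.mulS h S.op).extendOfNorm (X.mulT h) x) y : A) =
          ip x ((X.mulS h S.adj).extendOfNorm (X.mulT h) y)) ?_ ?_ x y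
      · exact isClosed_eq (continuous_ip (by fun_prop) (by fun_prop))
          (continuous_ip (by fun_prop) (by fun_prop))
      · intro s t
        rw [e1, e2]
        exact X.ip_mulS h S s t }

theorem tensorOp_mul {m n l : ι →₀ ℕ} (h : m + n = l) (hm : m ≠ 0) (hn : n ≠ 0)
    (S : Adjointable A (X.fib m)) (ξ : X.fib m) (η : X.fib n) :
    (X.tensorOp h hm hn S).op (X.mul h ξ η) = X.mul h (S.op ξ) η := by
  have : CompleteSpace (X.fib l) := RightHilbertModule.complete A
  rw [← X.mulT_tmul, ← X.mulS_tmul]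
  exact LinearMap.extendOfNorm_eq (f := X.mulS h S.op) (X.denseRange_mulT h hm hn)
    ⟨_, X.norm_mulS_le h S⟩ (ξ ⊗ₜ η)

theorem norm_tensorOp_le {m n l : ι →₀ ℕ} (h : m + n = l) (hm : m ≠ 0) (hn : n ≠ 0)
    (S : Adjointable A (X.fib m)) : ‖X.tensorOp h hm hn S‖ ≤ ‖S‖ := by
  have : CompleteSpace (X.fib l) := RightHilbertModule.complete A
  exact LinearMap.opNorm_extendOfNorm_le (X.denseRange_mulT h hm hn) (norm_nonneg S)
    (X.norm_mulS_le h S)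

open Classical in
/-- The map `ι_n^m` for `n ≤ m`: it sends `L_a ∈ 𝓚(X_0)` to `φ_m(a)` for `n = 0`, it is the
identity for `n = m`, and it is `S ↦ M_{n,m-n} (S ⊗ 1) M_{n,m-n}⁻¹` for `0 < n < m`. It is used on
compact operators only; for `n = 0` it has the value `0` on operators not of the form `L_a`. -/
noncomputable def iota {n m : ι →₀ ℕ} (h : n ≤ m) (S : Adjointable A (X.fib n)) :
    Adjointable A (X.fib m) :=
  if h0 : n = 0 then
    if ha : ∃ a, S = X.lact n a then X.lact m ha.choose else 0
  else if h1 : n = m then h1 ▸ S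
  else X.tensorOp (add_tsub_cancel_of_le h) h0 (fun h2 => h1 (le_antisymm h
    (tsub_eq_zero_iff_le.1 h2))) S

end ProductSystem

namespace ProductSystem

variable {ι : Type*} {A : Type*} [NonUnitalCStarAlgebra A] (X : ProductSystem ι A)

theorem lact_zero_injective : Function.Injective (X.lact 0) := by
  rw [injective_iff_map_eq_zero]
  intro a ha
  have h1 := X.lact_unit a (star a)
  rw [ha] at h1
  have h2 : a * star a = 0 := by
    apply X.unit.injective
    rw [← h1, map_zero]
    simp
  exact CStarRing.mul_star_self_eq_zero_iff _ |>.1 h2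

theorem norm_lact_zero (a : A) : ‖X.lact 0 a‖ = ‖a‖ :=
  NonUnitalStarAlgHom.norm_map (X.lact 0) X.lact_zero_injective a

theorem exists_eq_lact {S : Adjointable A (X.fib 0)} (hS : S ∈ compacts A (X.fib 0)) :
    ∃ a, S = X.lact 0 a := by
  have hi : Isometry (X.lact 0) := NonUnitalStarAlgHom.isometry (X.lact 0) X.lact_zero_injective
  refine compacts_induction (p := fun S => ∃ a, S = X.lact 0 a) ?_ ?_ ?_ ?_ ?_ hS
  · have : {T : Adjointable A (X.fib 0) | ∃ a, T = X.lact 0 a} = Set.range (X.lact 0) := by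
      ext T; simp [eq_comm]
    rw [this]
    exact hi.isClosedEmbedding.isClosed_range
  · exact ⟨0, (map_zero _).symm⟩
  · rintro _ _ ⟨a, rfl⟩ ⟨b, rfl⟩; exact ⟨a + b, (map_add _ _ _).symm⟩
  · rintro c _ ⟨a, rfl⟩; exact ⟨c • a, (map_smul _ _ _).symm⟩
  · intro ξ η
    obtain ⟨a, rfl⟩ := X.unit_surj ξ
    obtain ⟨b, rfl⟩ := X.unit_surj η
    refine ⟨a * star b, ext' fun z => ?_⟩
    obtain ⟨c, rfl⟩ := X.unit_surj z
    rw [rankOne_op, X.ip_unit, X.rsmul_unit, X.lact_unit, mul_assoc]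

theorem iota_lact {m : ι →₀ ℕ} (h : 0 ≤ m) (a : A) : X.iota h (X.lact 0 a) = X.lact m a := by
  have ha : ∃ b, X.lact 0 a = X.lact 0 b := ⟨a, rfl⟩
  have h1 : X.iota h (X.lact 0 a) = X.lact m ha.choose := by
    unfold iota
    rw [dif_pos rfl, dif_pos ha]
  rw [h1, ← X.lact_zero_injective ha.choose_spec]

theorem iota_self {n : ι →₀ ℕ} (h : n ≤ n) {S : Adjointable A (X.fib n)}
    (hS : S ∈ compacts A (X.fib n)) : X.iota h S = S := by
  by_cases h0 : n = 0
  · subst h0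
    obtain ⟨a, rfl⟩ := X.exists_eq_lact hS
    exact X.iota_lact h a
  · simp [iota, h0]

theorem iota_of_lt {n m : ι →₀ ℕ} (h : n ≤ m) (h0 : n ≠ 0) (h1 : n ≠ m)
    (hd : m - n ≠ 0) (S : Adjointable A (X.fib n)) :
    X.iota h S = X.tensorOp (add_tsub_cancel_of_le h) h0 hd S := by
  unfold iota
  rw [dif_neg h0, dif_neg h1]

theorem lact_mul {n d m : ι →₀ ℕ} (h : n + d = m) (a : A) (ξ : X.fib n) (η : X.fib d) :
    (X.lact m a).op (X.mul h ξ η) = X.mul h ((X.lact n a).op ξ) η := by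
  rw [← X.unit_mul (zero_add _), ← X.unit_mul (zero_add _)]
  exact (X.mul_mul _ _ _ _ _ _ _).symm

/-- The defining property `ι_n^m(S)(ξ η) = (S ξ) η`. -/
theorem iota_mul {n d m : ι →₀ ℕ} (h : n ≤ m) (hd : n + d = m) {S : Adjointable A (X.fib n)}
    (hS : S ∈ compacts A (X.fib n)) (ξ : X.fib n) (η : X.fib d) :
    (X.iota h S).op (X.mul hd ξ η) = X.mul hd (S.op ξ) η := by
  by_cases h0 : n = 0
  · subst h0
    obtain ⟨a, rfl⟩ := X.exists_eq_lact hS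
    rw [X.iota_lact, X.lact_mul]
  by_cases h1 : n = m
  · subst h1
    obtain rfl : d = 0 := by simpa using hd
    obtain ⟨a, rfl⟩ := X.unit_surj η
    rw [X.iota_self h hS, X.mul_unit, X.mul_unit, op_rsmul]
  obtain rfl : d = m - n := by rw [← hd, add_tsub_cancel_left]
  have hd0 : m - n ≠ 0 := fun h2 => h1 (by simpa [h2] using hd)
  rw [X.iota_of_lt h h0 h1 hd0, tensorOp_mul]

theorem ext_mul {m n l : ι →₀ ℕ} (h : m + n = l) (hm : m ≠ 0) (hn : n ≠ 0)
    {S T : Adjointable A (X.fib l)} (hST : ∀ ξ η, S.op (X.mul h ξ η) = T.op (X.mul h ξ η)) :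
    S = T := by
  refine ext' fun x => ?_
  refine (X.denseRange_mulT h hm hn).induction_on (p := fun x => S.op x = T.op x) x
    (isClosed_eq S.op.continuous T.op.continuous) fun t => ?_
  induction t with
  | zero => simp
  | add s t hs ht => simp only [map_add, hs, ht]
  | tmul ξ η => rw [X.mulT_tmul, hST]

theorem tensorOp_add {m n l : ι →₀ ℕ} (h : m + n = l) (hm : m ≠ 0) (hn : n ≠ 0)
    (S T : Adjointable A (X.fib m)) :
    X.tensorOp h hm hn (S + T) = X.tensorOp h hm hn S + X.tensorOp h hm hn T :=
  X.ext_mul h hm hn fun ξ η => by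
    rw [add_op, _root_.add_apply, tensorOp_mul, tensorOp_mul, tensorOp_mul]; simp

theorem tensorOp_smul {m n l : ι →₀ ℕ} (h : m + n = l) (hm : m ≠ 0) (hn : n ≠ 0)
    (c : ℂ) (S : Adjointable A (X.fib m)) :
    X.tensorOp h hm hn (c • S) = c • X.tensorOp h hm hn S :=
  X.ext_mul h hm hn fun ξ η => by
    rw [smul_op, _root_.smul_apply, tensorOp_mul, tensorOp_mul]; simp

theorem iota_add {n m : ι →₀ ℕ} (h : n ≤ m) {S T : Adjointable A (X.fib n)}
    (hS : S ∈ compacts A (X.fib n)) (hT : T ∈ compacts A (X.fib n)) :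
    X.iota h (S + T) = X.iota h S + X.iota h T := by
  by_cases h0 : n = 0
  · subst h0
    obtain ⟨a, rfl⟩ := X.exists_eq_lact hS
    obtain ⟨b, rfl⟩ := X.exists_eq_lact hT
    rw [← map_add, iota_lact, iota_lact, iota_lact, map_add]
  by_cases h1 : n = m
  · subst h1
    rw [X.iota_self h hS, X.iota_self h hT, X.iota_self h (add_mem hS hT)]
  have hd0 : m - n ≠ 0 := fun h2 => h1 (le_antisymm h (tsub_eq_zero_iff_le.1 h2))
  simp only [X.iota_of_lt h h0 h1 hd0, tensorOp_add]

theorem iota_smul {n m : ι →₀ ℕ} (h : n ≤ m) (c : ℂ) {S : Adjointable A (X.fib n)}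
    (hS : S ∈ compacts A (X.fib n)) : X.iota h (c • S) = c • X.iota h S := by
  by_cases h0 : n = 0
  · subst h0
    obtain ⟨a, rfl⟩ := X.exists_eq_lact hS
    rw [← map_smul, iota_lact, iota_lact, map_smul]
  by_cases h1 : n = m
  · subst h1
    rw [X.iota_self h hS, X.iota_self h (Submodule.smul_mem _ c hS)]
  have hd0 : m - n ≠ 0 := fun h2 => h1 (le_antisymm h (tsub_eq_zero_iff_le.1 h2))
  simp only [X.iota_of_lt h h0 h1 hd0, tensorOp_smul]

theorem star_iota {n m : ι →₀ ℕ} (h : n ≤ m) {S : Adjointable A (X.fib n)}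
    (hS : S ∈ compacts A (X.fib n)) : star (X.iota h S) = X.iota h (star S) := by
  by_cases h0 : n = 0
  · subst h0
    obtain ⟨a, rfl⟩ := X.exists_eq_lact hS
    rw [← map_star, iota_lact, iota_lact, map_star]
  by_cases h1 : n = m
  · subst h1
    rw [X.iota_self h hS, X.iota_self h (star_mem_compacts hS)]
  have hd0 : m - n ≠ 0 := fun h2 => h1 (le_antisymm h (tsub_eq_zero_iff_le.1 h2))
  rw [X.iota_of_lt h h0 h1 hd0, X.iota_of_lt h h0 h1 hd0]
  rfl

theorem norm_iota_le {n m : ι →₀ ℕ} (h : n ≤ m) {S : Adjointable A (X.fib n)}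
    (hS : S ∈ compacts A (X.fib n)) : ‖X.iota h S‖ ≤ ‖S‖ := by
  by_cases h0 : n = 0
  · subst h0
    obtain ⟨a, rfl⟩ := X.exists_eq_lact hS
    rw [iota_lact, norm_lact_zero]
    exact NonUnitalStarAlgHom.norm_apply_le _ _
  by_cases h1 : n = m
  · subst h1
    rw [X.iota_self h hS]
  have hd0 : m - n ≠ 0 := fun h2 => h1 (le_antisymm h (tsub_eq_zero_iff_le.1 h2))
  rw [X.iota_of_lt h h0 h1 hd0]
  exact X.norm_tensorOp_le _ h0 hd0 S

theorem iota_mul' {n s d r : ι →₀ ℕ} (h : n ≤ s) (h' : n ≤ r) (hd : s + d = r)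
    {S : Adjointable A (X.fib n)} (hS : S ∈ compacts A (X.fib n)) (ζ : X.fib s) (η : X.fib d) :
    (X.iota h' S).op (X.mul hd ζ η) = X.mul hd ((X.iota h S).op ζ) η := by
  by_cases h0 : n = 0
  · subst h0
    obtain ⟨a, rfl⟩ := X.exists_eq_lact hS
    rw [iota_lact, iota_lact, lact_mul]
  by_cases h1 : n = s
  · subst h1
    rw [X.iota_self h hS, X.iota_mul h' hd hS]
  have hd0 : s - n ≠ 0 := fun h2 => h1 (le_antisymm h (tsub_eq_zero_iff_le.1 h2))
  have he : n + (s - n) = s := add_tsub_cancel_of_le h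
  have hr : n + ((s - n) + d) = r := by rw [← add_assoc, he, hd]
  refine (X.denseRange_mulT he h0 hd0).induction_on
    (p := fun ζ => (X.iota h' S).op (X.mul hd ζ η) = X.mul hd ((X.iota h S).op ζ) η) ζ
    (isClosed_eq ((X.iota h' S).op.continuous.comp (X.continuous_mul_left hd η))
      ((X.continuous_mul_left hd η).comp (X.iota h S).op.continuous)) fun t => ?_
  induction t with
  | zero => simp
  | add s t hs ht => simp only [map_add, LinearMap.add_apply, hs, ht]
  | tmul ξ ξ' =>
    rw [X.mulT_tmul, X.iota_mul h he hS, X.mul_mul he hd rfl hr, X.mul_mul he hd rfl hr,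
      X.iota_mul h' hr hS]

theorem iota_mul_iota {p q s r : ι →₀ ℕ} (hp : p ≤ s) (hq : q ≤ s) (hs : s ≤ r) (hp' : p ≤ r)
    (hq' : q ≤ r) {S : Adjointable A (X.fib p)} (hS : S ∈ compacts A (X.fib p))
    {T : Adjointable A (X.fib q)} (hT : T ∈ compacts A (X.fib q))
    (hST : X.iota hp S * X.iota hq T ∈ compacts A (X.fib s)) :
    X.iota hp' S * X.iota hq' T = X.iota hs (X.iota hp S * X.iota hq T) := by
  by_cases h0 : s = 0
  · subst h0
    obtain rfl : p = 0 := le_antisymm hp (zero_le)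
    obtain rfl : q = 0 := le_antisymm hq (zero_le)
    obtain ⟨a, rfl⟩ := X.exists_eq_lact hS
    obtain ⟨b, rfl⟩ := X.exists_eq_lact hT
    simp only [iota_lact, ← map_mul]
  by_cases h1 : s = r
  · subst h1
    rw [X.iota_self hs hST]
  have hd0 : r - s ≠ 0 := fun h2 => h1 (le_antisymm hs (tsub_eq_zero_iff_le.1 h2))
  have he : s + (r - s) = r := add_tsub_cancel_of_le hs
  refine X.ext_mul he h0 hd0 fun ζ η => ?_
  rw [X.iota_mul hs he hST, mul_op, mul_op]
  change (X.iota hp' S).op ((X.iota hq' T).op _) =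
    X.mul he ((X.iota hp S).op ((X.iota hq T).op ζ)) η
  rw [X.iota_mul' hq hq' he hT, X.iota_mul' hp hp' he hS]

/-- `X` is compactly aligned if `ι_m^{m ∨ n}(S) ι_n^{m ∨ n}(T)` is compact for all compact
operators `S` on `X_m` and `T` on `X_n`. -/
def CompactlyAligned : Prop :=
  ∀ (m n : ι →₀ ℕ), ∀ S ∈ compacts A (X.fib m), ∀ T ∈ compacts A (X.fib n),
    X.iota (le_sup_left : m ≤ m ⊔ n) S * X.iota (le_sup_right : n ≤ m ⊔ n) T ∈
      compacts A (X.fib (m ⊔ n))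

open Classical in
/-- The finite set of all `p ≤ n`. -/
noncomputable def below (n : ι →₀ ℕ) : Finset (ι →₀ ℕ) := Finset.Icc 0 n

theorem mem_below {p n : ι →₀ ℕ} : p ∈ below n ↔ p ≤ n := by
  classical
  simp [below]

theorem below_mem (n : ι →₀ ℕ) (p : below n) : (p : ι →₀ ℕ) ≤ n := mem_below.1 p.2

/-- The finite direct sum `⨁_{r ≤ q} 𝓛(X_r I_{q - r})`. -/
def OpSum (q : ι →₀ ℕ) : Type _ := ∀ r : below q, Adjointable A (X.fibIdeal r (q - r))

noncomputable instance (q : ι →₀ ℕ) : NonUnitalCStarAlgebra (X.OpSum q) :=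
  inferInstanceAs (NonUnitalCStarAlgebra
    (∀ r : below q, Adjointable A (X.fibIdeal r (q - r))))

theorem restr_mul {q : ι →₀ ℕ} (n : ι →₀ ℕ) (S T : Adjointable A (X.fib q)) :
    X.restr n (S * T) = X.restr n S * X.restr n T := rfl

theorem norm_restr_le {q : ι →₀ ℕ} (n : ι →₀ ℕ) (T : Adjointable A (X.fib q)) :
    ‖X.restr n T‖ ≤ ‖T‖ :=
  ContinuousLinearMap.opNorm_le_bound _ (norm_nonneg _) fun x => T.op.le_opNorm x

open Classical in
/-- The component at `r` of `ι̃_p^{r + n}(S)`: the restriction of `ι_p^r(S)` to `X_r I_n` if `p ≤ r`,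
and `0` otherwise. -/
noncomputable def iotaComp (p r n : ι →₀ ℕ) (S : compacts A (X.fib p)) :
    Adjointable A (X.fibIdeal r n) :=
  if h : p ≤ r then X.restr n (X.iota h S.1) else 0

theorem iotaComp_add (p r n : ι →₀ ℕ) (S T : compacts A (X.fib p)) :
    X.iotaComp p r n (S + T) = X.iotaComp p r n S + X.iotaComp p r n T := by
  unfold iotaComp
  split_ifs with h
  · rw [Submodule.coe_add, X.iota_add h S.2 T.2]; rfl
  · rw [add_zero]

theorem iotaComp_smul (p r n : ι →₀ ℕ) (c : ℂ) (S : compacts A (X.fib p)) :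
    X.iotaComp p r n (c • S) = c • X.iotaComp p r n S := by
  unfold iotaComp
  split_ifs with h
  · rw [Submodule.coe_smul, X.iota_smul h c S.2]; rfl
  · rw [smul_zero]

theorem star_iotaComp (p r n : ι →₀ ℕ) (S : compacts A (X.fib p)) :
    star (X.iotaComp p r n S) = X.iotaComp p r n ⟨star S.1, star_mem_compacts S.2⟩ := by
  unfold iotaComp
  split_ifs with h
  · rw [← X.star_iota h S.2]; rfl
  · rw [star_zero]

theorem norm_iotaComp_le (p r n : ι →₀ ℕ) (S : compacts A (X.fib p)) :
    ‖X.iotaComp p r n S‖ ≤ ‖S‖ := by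
  unfold iotaComp
  split_ifs with h
  · exact (X.norm_restr_le _ _).trans (X.norm_iota_le h S.2)
  · rw [norm_zero]; exact norm_nonneg _

theorem iotaComp_mul (hX : X.CompactlyAligned) (p p' r n : ι →₀ ℕ) (S : compacts A (X.fib p))
    (T : compacts A (X.fib p')) : X.iotaComp p r n S * X.iotaComp p' r n T =
      X.iotaComp (p ⊔ p') r n ⟨_, hX p p' S S.2 T T.2⟩ := by
  unfold iotaComp
  by_cases h1 : p ≤ r
  · by_cases h2 : p' ≤ r
    · rw [dif_pos h1, dif_pos h2, dif_pos (sup_le h1 h2), ← restr_mul,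
        X.iota_mul_iota le_sup_left le_sup_right (sup_le h1 h2) h1 h2 S.2 T.2 (hX p p' S S.2 T T.2)]
    · rw [dif_neg h2, dif_neg fun h => h2 (le_sup_right.trans h), mul_zero]
  · rw [dif_neg h1, dif_neg fun h => h1 (le_sup_left.trans h), zero_mul]

/-- The map `ι̃_p^q : 𝓚(X_p) → ⨁_{r ≤ q} 𝓛(X_r I_{q - r})`; the component of `ι̃_p^q(S)` at `r` is
the restriction of `ι_p^r(S)` if `p ≤ r`, and `0` otherwise. -/
noncomputable def iotaTilde (p q : ι →₀ ℕ) : compacts A (X.fib p) →ₗ[ℂ] X.OpSum q where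
  toFun S := fun r => X.iotaComp p r (q - r) S
  map_add' S T := funext fun r => X.iotaComp_add p r (q - r) S T
  map_smul' c S := funext fun r => X.iotaComp_smul p r (q - r) c S

theorem norm_iotaTilde_le (p q : ι →₀ ℕ) (S : compacts A (X.fib p)) :
    ‖X.iotaTilde p q S‖ ≤ ‖S‖ :=
  (pi_norm_le_iff_of_nonneg (norm_nonneg _)).2 fun r => X.norm_iotaComp_le p r (q - r) S

theorem star_iotaTilde (p q : ι →₀ ℕ) (S : compacts A (X.fib p)) :
    star (X.iotaTilde p q S) = X.iotaTilde p q ⟨star S.1, star_mem_compacts S.2⟩ :=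
  funext fun r => X.star_iotaComp p r (q - r) S

theorem iotaTilde_mul (hX : X.CompactlyAligned) (p p' q : ι →₀ ℕ) (S : compacts A (X.fib p))
    (T : compacts A (X.fib p')) : X.iotaTilde p q S * X.iotaTilde p' q T =
      X.iotaTilde (p ⊔ p') q ⟨_, hX p p' S S.2 T T.2⟩ :=
  funext fun r => X.iotaComp_mul hX p p' r (q - r) S T

end ProductSystem

namespace ProductSystem

variable {ι : Type*} {A : Type*} [NonUnitalCStarAlgebra A] (X : ProductSystem ι A)

/-- A family of contractions as one linear map into the product C*-algebra. -/
noncomputable def prodMap {I V : Type*} {B : I → Type*} [NormedAddCommGroup V] [NormedSpace ℂ V]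
    [∀ i, NonUnitalCStarAlgebra (B i)] (L : ∀ i, V →ₗ[ℂ] B i) (hL : ∀ i v, ‖L i v‖ ≤ ‖v‖) :
    V →ₗ[ℂ] lp B ⊤ where
  toFun v := ⟨fun i => L i v, memℓp_infty ⟨‖v‖, by rintro _ ⟨i, rfl⟩; exact hL i v⟩⟩
  map_add' v w := by ext i : 2; exact map_add (L i) v w
  map_smul' c v := by ext i : 2; exact map_smul (L i) c v

/-- The C*-algebra `∏_{q ≥ n} ⨁_{r ≤ q} 𝓛(X_r I_{q - r})` of bounded families, with the
supremum norm. -/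
def OpProd (n : ι →₀ ℕ) : Type _ := lp (fun q : Set.Ici n => X.OpSum q) ⊤

noncomputable instance (n : ι →₀ ℕ) : NonUnitalCStarAlgebra (X.OpProd n) :=
  inferInstanceAs (NonUnitalCStarAlgebra (lp (fun q : Set.Ici n => X.OpSum q) ⊤))

variable {X} in
theorem OpProd.ext {n : ι →₀ ℕ} {x y : X.OpProd n} (h : ∀ q, x.1 q = y.1 q) : x = y :=
  Subtype.ext (funext h)

/-- The component at `q` of an element of the product. -/
noncomputable def comp {n : ι →₀ ℕ} (q : Set.Ici n) : X.OpProd n →⋆ₙₐ[ℂ] X.OpSum q where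
  toFun x := x.1 q
  map_smul' _ _ := rfl
  map_zero' := rfl
  map_add' _ _ := rfl
  map_mul' _ _ := rfl
  map_star' _ := rfl

theorem norm_comp_le {n : ι →₀ ℕ} (q : Set.Ici n) (x : X.OpProd n) : ‖X.comp q x‖ ≤ ‖x‖ :=
  lp.norm_apply_le_norm (by simp) x q

/-- The restriction of a family indexed by `q ≥ n` to the indices `q ≥ m`, for `n ≤ m`. -/
noncomputable def tail {n m : ι →₀ ℕ} (h : n ≤ m) : X.OpProd n →⋆ₙₐ[ℂ] X.OpProd m where
  toFun x := ⟨fun q : Set.Ici m => X.comp ⟨q, h.trans q.2⟩ x,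
    memℓp_infty ⟨‖x‖, by rintro _ ⟨q, rfl⟩; exact X.norm_comp_le _ x⟩⟩
  map_smul' _ _ := rfl
  map_zero' := rfl
  map_add' _ _ := rfl
  map_mul' _ _ := rfl
  map_star' _ := rfl

theorem norm_tail_le {n m : ι →₀ ℕ} (h : n ≤ m) (x : X.OpProd n) : ‖X.tail h x‖ ≤ ‖x‖ :=
  lp.norm_le_of_forall_le (norm_nonneg _) fun _ => X.norm_comp_le _ x

/-- The family `(ι̃_p^q(S))_{q ≥ n}`. -/
noncomputable def tilde (n p : ι →₀ ℕ) : compacts A (X.fib p) →ₗ[ℂ] X.OpProd n :=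
  prodMap (B := fun q : Set.Ici n => X.OpSum q) (fun q => X.iotaTilde p q)
    (fun q S => X.norm_iotaTilde_le p q S)

/-- The family `(∑_{p ≤ n} ι̃_p^q(S_p))_{q ≥ n}`. -/
noncomputable def family (n : ι →₀ ℕ) :
    (∀ p : below n, compacts A (X.fib p)) →ₗ[ℂ] X.OpProd n :=
  ∑ p : below n, X.tilde n p ∘ₗ LinearMap.proj p

theorem family_apply (n : ι →₀ ℕ) (S : ∀ p : below n, compacts A (X.fib p)) :
    X.family n S = ∑ p : below n, X.tilde n p (S p) := by
  simp only [family, LinearMap.sum_apply]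
  rfl

theorem family_coe (n : ι →₀ ℕ) (S : ∀ p : below n, compacts A (X.fib p)) (q : Set.Ici n) :
    X.comp q (X.family n S) = ∑ p : below n, X.iotaTilde p q (S p) := by
  rw [family_apply, map_sum]
  rfl

theorem tilde_mem {n p : ι →₀ ℕ} (hp : p ≤ n) (S : compacts A (X.fib p)) :
    X.tilde n p S ∈ LinearMap.range (X.family n) := by
  classical
  refine ⟨Pi.single (⟨p, mem_below.2 hp⟩ : below n) S, ?_⟩
  rw [family_apply, Finset.sum_eq_single (⟨p, mem_below.2 hp⟩ : below n)]
  · simp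
  · intro b _ hb; simp [Pi.single_eq_of_ne hb]
  · simp

variable {X} in
/-- The C*-algebra `C̃_n`, which consists of the families `(∑_{p ≤ n} ι̃_p^q(S_p))_{q ≥ n}` with
`S_p ∈ 𝓚(X_p)`. Compact alignment ensures that it is closed under multiplication. -/
noncomputable def Ctilde (hX : X.CompactlyAligned) (n : ι →₀ ℕ) :
    NonUnitalStarSubalgebra ℂ (X.OpProd n) where
  __ := LinearMap.range (X.family n)
  mul_mem' := by
    rintro _ _ ⟨S, rfl⟩ ⟨T, rfl⟩
    change _ ∈ LinearMap.range (X.family n)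
    rw [family_apply, family_apply, Finset.sum_mul_sum]
    refine sum_mem fun p _ => sum_mem fun p' _ => ?_
    have : X.tilde n p (S p) * X.tilde n p' (T p') =
        X.tilde n (p ⊔ p') ⟨_, hX p p' _ (S p).2 _ (T p').2⟩ := by
      exact OpProd.ext fun q => X.iotaTilde_mul hX p p' q (S p) (T p')
    rw [this]
    exact X.tilde_mem (sup_le (below_mem n p) (below_mem n p')) _
  star_mem' := by
    rintro _ ⟨S, rfl⟩
    change _ ∈ LinearMap.range (X.family n)
    rw [family_apply, star_sum]
    refine sum_mem fun p _ => ?_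
    have : star (X.tilde n p (S p)) = X.tilde n p ⟨star (S p).1, star_mem_compacts (S p).2⟩ := by
      exact OpProd.ext fun q => X.star_iotaTilde p q (S p)
    rw [this]
    exact X.tilde_mem (below_mem n p) _

variable {X}

/-- The element `(∑_{p ≤ n} ι̃_p^q(S_p))_{q ≥ n}` of `C̃_n`. -/
noncomputable def Ctilde.mk (hX : X.CompactlyAligned) (n : ι →₀ ℕ)
    (S : ∀ p : below n, compacts A (X.fib p)) : Ctilde hX n := ⟨X.family n S, S, rfl⟩

theorem tail_mem (hX : X.CompactlyAligned) {n m : ι →₀ ℕ} (h : n ≤ m) (x : Ctilde hX n) :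
    X.tail h x.1 ∈ Ctilde hX m := by
  obtain ⟨x, S, rfl⟩ := x
  change X.tail h (X.family n S) ∈ LinearMap.range (X.family m)
  rw [family_apply, map_sum]
  exact sum_mem fun p _ => X.tilde_mem ((below_mem n p).trans h) _

/-- The *-homomorphism `j̃_{m,n} : C̃_n → C̃_m`, which restricts a family indexed by `q ≥ n` to the
indices `q ≥ m`. -/
noncomputable def jtilde (hX : X.CompactlyAligned) (n m : ι →₀ ℕ) (h : n ≤ m) :
    Ctilde hX n →⋆ₙₐ[ℂ] Ctilde hX m where
  toFun x := ⟨X.tail h x.1, tail_mem hX h x⟩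
  map_smul' _ _ := rfl
  map_zero' := rfl
  map_add' _ _ := rfl
  map_mul' _ _ := rfl
  map_star' _ := rfl

theorem norm_jtilde_le (hX : X.CompactlyAligned) (n m : ι →₀ ℕ) (h : n ≤ m) (x : Ctilde hX n) :
    ‖jtilde hX n m h x‖ ≤ ‖x‖ :=
  X.norm_tail_le h x.1

instance (hX : X.CompactlyAligned) (n : ι →₀ ℕ) : CStarRing (Ctilde hX n) where
  norm_mul_self_le x := CStarRing.norm_mul_self_le x.1

instance (hX : X.CompactlyAligned) : ContractiveSystem (fun n => Ctilde hX n) (jtilde hX) where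
  map_self _ _ := rfl
  map_map _ _ _ _ _ _ := rfl
  norm_le := norm_jtilde_le hX

/-- A representation of the product system `X` in the C*-algebra `B`. -/
structure Rep (X : ProductSystem ι A) (B : Type*) [NonUnitalCStarAlgebra B] where
  /-- the linear maps `ψ_n : X_n → B` -/
  map : ∀ n, X.fib n →ₗ[ℂ] B
  /-- `ψ_0` is a *-homomorphism on `A`; it is multiplicative by `map_mul`. -/
  map_unit_star : ∀ a, map 0 (X.unit (star a)) = star (map 0 (X.unit a))
  map_ip : ∀ {n} (ξ η : X.fib n), star (map n ξ) * map n η = map 0 (X.unit (ip ξ η))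
  map_lact : ∀ {n} (a : A) (ξ : X.fib n),
    map 0 (X.unit a) * map n ξ = map n ((X.lact n a).op ξ)
  map_mul : ∀ {m n l : ι →₀ ℕ} (h : m + n = l) (ξ : X.fib m) (η : X.fib n),
    map m ξ * map n η = map l (X.mul h ξ η)

namespace Rep

variable {B : Type*} [NonUnitalCStarAlgebra B] (ψ : Rep X B)

/-- The linear combination `∑ c_i θ_{ξ_i, η_i}` in `𝓚(X_n)`. -/
noncomputable def thetaComb (X : ProductSystem ι A) (n : ι →₀ ℕ) :
    (X.fib n × X.fib n →₀ ℂ) →ₗ[ℂ] compacts A (X.fib n) :=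
  Finsupp.linearCombination ℂ fun p => ⟨rankOne A p.1 p.2, rankOne_mem p.1 p.2⟩

/-- The linear combination `∑ c_i ψ_n(ξ_i) ψ_n(η_i)*` in `B`. -/
noncomputable def psiComb (n : ι →₀ ℕ) : (X.fib n × X.fib n →₀ ℂ) →ₗ[ℂ] B :=
  Finsupp.linearCombination ℂ fun p => ψ.map n p.1 * star (ψ.map n p.2)

theorem denseRange_thetaComb (n : ι →₀ ℕ) : DenseRange (thetaComb X n) := by
  intro T
  rw [closure_subtype]
  refine closure_mono ?_ T.2
  intro S hS
  induction hS using Submodule.span_induction with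
  | mem x hx =>
    obtain ⟨ξ, η, rfl⟩ := hx
    exact ⟨_, ⟨Finsupp.single (ξ, η) 1, rfl⟩, by simp [thetaComb]⟩
  | zero => exact ⟨0, ⟨0, map_zero _⟩, rfl⟩
  | add x y _ _ hx hy =>
    obtain ⟨_, ⟨s, rfl⟩, rfl⟩ := hx
    obtain ⟨_, ⟨t, rfl⟩, rfl⟩ := hy
    exact ⟨_, ⟨s + t, map_add _ _ _⟩, rfl⟩
  | smul c x _ hx =>
    obtain ⟨_, ⟨s, rfl⟩, rfl⟩ := hx
    exact ⟨_, ⟨c • s, map_smul _ _ _⟩, rfl⟩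

/-- `ψ_0` as a *-homomorphism on `A`. -/
def zeroHom : A →⋆ₙₐ[ℂ] B where
  toFun a := ψ.map 0 (X.unit a)
  map_smul' c a := by simp
  map_zero' := by simp
  map_add' a b := by simp
  map_mul' a b := by rw [ψ.map_lact, X.lact_unit]
  map_star' := ψ.map_unit_star

theorem norm_map_le {n : ι →₀ ℕ} (ξ : X.fib n) : ‖ψ.map n ξ‖ ≤ ‖ξ‖ := by
  refine abs_le_of_sq_le_sq' ?_ (norm_nonneg _) |>.2
  rw [norm_sq_eq (A := A) ξ, sq, ← CStarRing.norm_star_mul_self, ψ.map_ip]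
  exact NonUnitalStarAlgHom.norm_apply_le ψ.zeroHom _

theorem map_rsmul {n : ι →₀ ℕ} (ξ : X.fib n) (a : A) :
    ψ.map n (rsmul ξ a) = ψ.map n ξ * ψ.map 0 (X.unit a) := by
  rw [ψ.map_mul (add_zero n), X.mul_unit]

theorem psiComb_mul_map {n : ι →₀ ℕ} (t : X.fib n × X.fib n →₀ ℂ) (ζ : X.fib n) :
    ψ.psiComb n t * ψ.map n ζ = ψ.map n ((thetaComb X n t).1.op ζ) := by
  induction t using Finsupp.induction_linear with
  | zero => simp
  | add s t hs ht => simp [add_mul, hs, ht]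
  | single p c =>
    simp only [psiComb, thetaComb, Finsupp.linearCombination_single]
    rw [Submodule.coe_smul, smul_op, _root_.smul_apply, map_smul, rankOne_op, map_rsmul,
      smul_mul_assoc, mul_assoc, ψ.map_ip]

theorem star_psiComb_mul_map {n : ι →₀ ℕ} (t : X.fib n × X.fib n →₀ ℂ) (ζ : X.fib n) :
    star (ψ.psiComb n t) * ψ.map n ζ = ψ.map n ((star (thetaComb X n t).1).op ζ) := by
  induction t using Finsupp.induction_linear with
  | zero => simp
  | add s t hs ht => simp only [map_add, star_add, add_mul, hs, ht, Submodule.coe_add, add_op,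
      _root_.add_apply]
  | single p c =>
    simp only [psiComb, thetaComb, Finsupp.linearCombination_single]
    rw [Submodule.coe_smul, star_smul, star_smul, star_rankOne, smul_op, _root_.smul_apply,
      map_smul, rankOne_op, map_rsmul, star_mul, star_star, smul_mul_assoc, mul_assoc, ψ.map_ip]

theorem exists_bound (n : ι →₀ ℕ) (t : X.fib n × X.fib n →₀ ℂ) :
    ∃ C : ℝ, ∀ (b : B) (R : Adjointable A (X.fib n)),
      (∀ ζ, b * ψ.map n ζ = ψ.map n (R.op ζ)) → ‖b * ψ.psiComb n t‖ ≤ C * ‖R‖ := by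
  induction t using Finsupp.induction_linear with
  | zero => exact ⟨0, fun b R _ => by simp⟩
  | add s t hs ht =>
    obtain ⟨C, hC⟩ := hs
    obtain ⟨C', hC'⟩ := ht
    refine ⟨C + C', fun b R h => ?_⟩
    rw [map_add, mul_add, add_mul]
    exact (norm_add_le _ _).trans (add_le_add (hC b R h) (hC' b R h))
  | single p c =>
    refine ⟨‖c‖ * ‖p.1‖ * ‖p.2‖, fun b R h => ?_⟩
    have : b * ψ.psiComb n (Finsupp.single p c) =
        c • (ψ.map n (R.op p.1) * star (ψ.map n p.2)) := by
      simp only [psiComb, Finsupp.linearCombination_single]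
      rw [mul_smul_comm, ← mul_assoc, h]
    rw [this, norm_smul]
    calc _ ≤ ‖c‖ * (‖ψ.map n (R.op p.1)‖ * ‖star (ψ.map n p.2)‖) := by
          gcongr; exact _root_.norm_mul_le _ _
      _ ≤ ‖c‖ * ((‖R‖ * ‖p.1‖) * ‖p.2‖) := by
          rw [norm_star]
          gcongr
          · exact (ψ.norm_map_le _).trans (R.op.le_opNorm _)
          · exact ψ.norm_map_le _
      _ = _ := by ring

theorem norm_psiComb_le (n : ι →₀ ℕ) (t : X.fib n × X.fib n →₀ ℂ) :
    ‖ψ.psiComb n t‖ ≤ ‖thetaComb X n t‖ := by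
  set P := ψ.psiComb n t with hP
  set S := (thetaComb X n t).1 with hS
  change ‖P‖ ≤ ‖S‖
  -- the iterated squares of `P P*` and of `S S*`
  let Q : ℕ → B := fun k => Nat.rec (P * star P) (fun _ b => b * b) k
  let R : ℕ → Adjointable A (X.fib n) := fun k => Nat.rec (S * star S) (fun _ T => T * T) k
  have hQ : ∀ k, star (Q k) = Q k := by
    intro k
    induction k with
    | zero => simp [Q]
    | succ k ih => change star (Q k * Q k) = Q k * Q k; rw [star_mul, ih]
  have hR : ∀ k, star (R k) = R k := by
    intro k
    induction k with
    | zero => simp [R]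
    | succ k ih => change star (R k * R k) = R k * R k; rw [star_mul, ih]
  have hRn : ∀ k, ‖R k‖ = (‖S‖ ^ 2) ^ (2 ^ k) := by
    intro k
    induction k with
    | zero => simp [R, CStarRing.norm_self_mul_star, sq]
    | succ k ih =>
      change ‖R k * R k‖ = _
      have := CStarRing.norm_star_mul_self (x := R k)
      rw [hR] at this
      rw [this, ih]; ring
  have hQR : ∀ k ζ, Q k * ψ.map n ζ = ψ.map n ((R k).op ζ) := by
    intro k
    induction k with
    | zero =>
      intro ζ
      change P * star P * ψ.map n ζ = ψ.map n (S.op ((star S).op ζ))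
      rw [mul_assoc, star_psiComb_mul_map, psiComb_mul_map]
    | succ k ih =>
      intro ζ
      change Q k * Q k * ψ.map n ζ = ψ.map n ((R k).op ((R k).op ζ))
      rw [mul_assoc, ih, ih]
  obtain ⟨C, hC⟩ := ψ.exists_bound n t
  have main := le_of_sq_le_of_growth (b := fun k => ‖Q k * P‖)
    (x := ‖P‖) (r := ‖S‖ ^ 2) (C := C) (norm_nonneg _) (by positivity)
    (fun k => norm_nonneg _) (fun k => ?_) (fun k => ?_)
  · have h1 : ‖P‖ ^ 4 ≤ ‖P * star P * P‖ * ‖P‖ := by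
      calc ‖P‖ ^ 4 = ‖P * star P * (P * star P)‖ := by
            have := CStarRing.norm_star_mul_self (x := P * star P)
            rw [star_mul, star_star] at this
            rw [this, CStarRing.norm_self_mul_star]; ring
        _ = ‖P * star P * P * star P‖ := by rw [← mul_assoc]
        _ ≤ ‖P * star P * P‖ * ‖star P‖ := _root_.norm_mul_le _ _
        _ = _ := by rw [norm_star]
    have h2 : ‖P * star P * P‖ ≤ ‖S‖ ^ 2 * ‖P‖ := main
    rcases (norm_nonneg P).eq_or_lt with h0 | h0
    · rw [← h0]; exact norm_nonneg _
    · have h3 : ‖P‖ ^ 2 * ‖P‖ ^ 2 ≤ ‖S‖ ^ 2 * ‖P‖ ^ 2 := by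
        calc _ = ‖P‖ ^ 4 := by ring
          _ ≤ ‖P * star P * P‖ * ‖P‖ := h1
          _ ≤ ‖S‖ ^ 2 * ‖P‖ * ‖P‖ := by gcongr
          _ = _ := by ring
      have h4 := le_of_mul_le_mul_right h3 (by positivity)
      exact abs_le_of_sq_le_sq' h4 (norm_nonneg _) |>.2
  · change ‖Q k * P‖ ^ 2 ≤ ‖P‖ * ‖Q k * Q k * P‖
    rw [sq, ← CStarRing.norm_star_mul_self, star_mul, hQ]
    calc ‖star P * Q k * (Q k * P)‖ = ‖star P * (Q k * Q k * P)‖ := by simp only [mul_assoc]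
      _ ≤ ‖star P‖ * ‖Q k * Q k * P‖ := _root_.norm_mul_le _ _
      _ = _ := by rw [norm_star]
  · rw [← hRn]; exact hC _ _ (hQR k)

/-- The *-homomorphism `ψ^{(n)} : 𝓚(X_n) → B` with `ψ^{(n)}(θ_{ξ, η}) = ψ_n(ξ) ψ_n(η)*`, as a
bounded linear map. -/
noncomputable def onCompacts (n : ι →₀ ℕ) : compacts A (X.fib n) →L[ℂ] B :=
  (ψ.psiComb n).extendOfNorm (thetaComb X n)

theorem onCompacts_rankOne {n : ι →₀ ℕ} (ξ η : X.fib n) :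
    ψ.onCompacts n ⟨rankOne A ξ η, rankOne_mem ξ η⟩ = ψ.map n ξ * star (ψ.map n η) := by
  have := LinearMap.extendOfNorm_eq (f := ψ.psiComb n) (denseRange_thetaComb (X := X) n)
    ⟨1, fun t => by simpa using ψ.norm_psiComb_le n t⟩ (Finsupp.single (ξ, η) 1)
  rw [psiComb, Finsupp.linearCombination_single, one_smul] at this
  rw [← this, onCompacts, psiComb]
  congr 1
  simp [thetaComb]

/-- Nica covariance. -/
def IsNica (hX : X.CompactlyAligned) : Prop :=
  ∀ (m n : ι →₀ ℕ) (S : compacts A (X.fib m)) (T : compacts A (X.fib n)),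
    ψ.onCompacts m S * ψ.onCompacts n T =
      ψ.onCompacts (m ⊔ n) ⟨_, hX m n S S.2 T T.2⟩

/-- Cuntz-Nica-Pimsner covariance: `ψ` is Nica covariant, and `∑_{p ∈ F} ψ^{(p)}(S_p) = 0` whenever
`F` is finite, `S_p ∈ 𝓚(X_p)` for `p ∈ F`, and `∑_{p ∈ F} ι̃_p^q(S_p) = 0` for large `q`, that is,
for every `n` there is an `m ≥ n` such that this holds for all `q ≥ m`. -/
def IsCNP (hX : X.CompactlyAligned) : Prop :=
  ψ.IsNica hX ∧
    ∀ (F : Finset (ι →₀ ℕ)) (S : ∀ p, compacts A (X.fib p)),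
      (∀ n : ι →₀ ℕ, ∃ m, n ≤ m ∧ ∀ q, m ≤ q → ∑ p ∈ F, X.iotaTilde p q (S p) = 0) →
      ∑ p ∈ F, ψ.onCompacts p (S p) = 0

/-- A representation is injective if `ψ_0` is (all `ψ_n` are then isometric). -/
def IsInjective : Prop := Function.Injective (ψ.map 0)

/-- The core `C*(ψ)^core`, the closed linear span of the elements `ψ_n(ξ) ψ_n(η)*`. -/
noncomputable def core : Submodule ℂ B :=
  (Submodule.span ℂ {b | ∃ (n : ι →₀ ℕ) (ξ η : X.fib n),
    b = ψ.map n ξ * star (ψ.map n η)}).topologicalClosure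

end Rep

end ProductSystem

/-! Let B_n be the sum of the ψ^{(p)}(𝓚(X_p)) over p ≤ n. By Nica covariance B_n is a *-algebra. The
B_n increase with n and the closure of their union is the core, so it is enough to match C̃_n with
B_n isometrically and compatibly in n. A compatible cone of isometric *-homomorphisms extends
isometrically to the inductive limit, and its range is the closure of the union
(`CStarLimit.exists_isometric_lift`).

That an element of C̃_n determines the element of B_n is CNP covariance: a family that vanishes at
all q ≥ n satisfies the hypothesis of the covariance condition (`IsCNP.sumOver_eq_zero`).

Conversely, B_n acts by left multiplication on ψ_r(X_r I_{q-r}), which is an isometric copy of X_r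
I_{q-r} because ψ is injective. If p ≤ r, then ψ^{(p)}(S) acts there as ι_p^r(S). If p ≰ r, it acts
as 0: by Nica covariance its product with ψ^{(r)}(θ_{ξ,ξ}) involves ι_r^{p∨r}(θ_{ξ,ξ}), and this
operator vanishes since ξ annihilates X_d for 0 < d ≤ q - r. So the action is exactly the component
of ι̃_p^q(S) at r, and the norm of the family is at most the norm of the sum in B
(`IsInjective.norm_family_le`).

For the reverse inequality, consider the *-algebra of all pairs (family, sum) inside the product
with B. If it is closed, it is a C*-algebra, and its projection to the first coordinate is an
injective *-homomorphism, hence isometric (`IsCNP.norm_snd_eq`). Closedness of the pairs follows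
from the first inequality once B_n is closed. That is proved by induction over finite join-closed
index sets: a minimal p is removed, what remains absorbs multiplication by ψ^{(p)}(𝓚(X_p)), and the
sum of a C*-subalgebra and another one that absorbs it is closed (`isClosed_sup_of_mul_mem`). -/

/-! ### Closedness of sums of C*-subalgebras -/

section SumClosed

variable {B : Type*} [NonUnitalCStarAlgebra B]

/-- The truncation `t ↦ max (-ε) (min ε t)`. -/
noncomputable def realClip (ε t : ℝ) : ℝ := max (-ε) (min ε t)

theorem continuous_realClip (ε : ℝ) : Continuous (realClip ε) := by
  unfold realClip; fun_prop

theorem realClip_zero {ε : ℝ} (hε : 0 ≤ ε) : realClip ε 0 = 0 := by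
  simp [realClip, hε]

theorem abs_realClip_le {ε : ℝ} (hε : 0 ≤ ε) (t : ℝ) : |realClip ε t| ≤ ε :=
  abs_le.2 ⟨le_max_left _ _, max_le (by linarith) (min_le_left _ _)⟩

theorem realClip_eq {ε t : ℝ} (ht : |t| ≤ ε) : realClip ε t = t := by
  rw [realClip, min_eq_right (abs_le.1 ht).2, max_eq_right (abs_le.1 ht).1]

/-- The pairs `(x, y)` with `x ∈ K` and `x - y ∈ J`. -/
def congruencePairs (J K : NonUnitalStarSubalgebra ℂ B) (h : ∀ k ∈ K, ∀ j ∈ J, k * j ∈ J) :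
    NonUnitalStarSubalgebra ℂ (B × B) where
  carrier := {z | z.1 ∈ K ∧ z.1 - z.2 ∈ J}
  add_mem' {z w} hz hw := ⟨add_mem hz.1 hw.1, by
    rw [Prod.fst_add, Prod.snd_add, add_sub_add_comm]; exact add_mem hz.2 hw.2⟩
  zero_mem' := ⟨zero_mem _, by simp⟩
  smul_mem' c z hz := ⟨SMulMemClass.smul_mem c hz.1, by
    rw [Prod.smul_fst, Prod.smul_snd, ← smul_sub]; exact SMulMemClass.smul_mem c hz.2⟩
  star_mem' {z} hz := ⟨star_mem hz.1, by
    rw [Prod.fst_star, Prod.snd_star, ← star_sub]; exact star_mem hz.2⟩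
  mul_mem' {z w} hz hw := ⟨mul_mem hz.1 hw.1, by
    -- Both algebras are selfadjoint, so absorption on the left gives absorption on the right by
    -- taking adjoints.
    have h' : ∀ j ∈ J, ∀ k ∈ K, j * k ∈ J := fun j hj k hk => by
      rw [← star_star (j * k), star_mul]
      exact star_mem (h _ (star_mem hk) _ (star_mem hj))
    have e : (z * w).1 - (z * w).2 =
        z.1 * (w.1 - w.2) + ((z.1 - z.2) * w.1 - (z.1 - z.2) * (w.1 - w.2)) := by
      rw [Prod.fst_mul, Prod.snd_mul]; noncomm_ring
    rw [e]
    exact add_mem (h _ hz.1 _ hw.2) (sub_mem (h' _ hz.2 _ hw.1) (mul_mem hz.2 hw.2))⟩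

/-- A selfadjoint `k ∈ K` is as close to `J ⊓ K` as it is to `J`. -/
theorem exists_mem_inf_norm_sub_le {J K : NonUnitalStarSubalgebra ℂ B}
    (hJ : IsClosed (J : Set B)) (hK : IsClosed (K : Set B)) (h : ∀ k ∈ K, ∀ j ∈ J, k * j ∈ J)
    {k j : B} (hk : k ∈ K) (hj : j ∈ J) (hks : IsSelfAdjoint k) (hjs : IsSelfAdjoint j) :
    ∃ l ∈ J, l ∈ K ∧ ‖k - l‖ ≤ ‖k + j‖ := by
  set ε := ‖k + j‖ with hε
  have hε0 : 0 ≤ ε := norm_nonneg _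
  have hc := continuous_realClip ε
  have hz := realClip_zero hε0
  -- The element sought is f(k): f vanishes on [-ε, ε], hence kills k + j, while t - f(t) is bounded
  -- by ε.
  let f : ℝ → ℝ := fun t => t - realClip ε t
  have hf : Continuous f := continuous_id.sub hc
  have hf0 : f 0 = 0 := by simp [f, hz]
  have hkj : IsSelfAdjoint (k + j) := hks.add hjs
  have hfkj : cfcₙ f (k + j) = 0 := by
    rw [← cfcₙ_zero ℝ (k + j)]
    refine cfcₙ_congr fun t ht => ?_
    -- Spectral points of k + j have modulus at most ‖k + j‖ = ε.
    have := norm_apply_le_norm_cfcₙ (id : ℝ → ℝ) (k + j) ht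
    rw [cfcₙ_id ℝ (k + j)] at this
    simp [f, realClip_eq (ε := ε) (t := t) this]
  have hsub : k - cfcₙ f k = cfcₙ (realClip ε) k := by
    have : cfcₙ f k = k - cfcₙ (realClip ε) k := by
      rw [cfcₙ_sub (fun t : ℝ => t) (realClip ε) (a := k) (by fun_prop) rfl
        hc.continuousOn hz, cfcₙ_id' ℝ k]
    rw [this]; abel
  have hcl : IsClosed (congruencePairs J K h : Set (B × B)) :=
    (hK.preimage continuous_fst).inter (hJ.preimage (continuous_fst.sub continuous_snd))
  -- Functional calculus preserves congruence modulo J: the pair (k, k + j) lies in a closed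
  -- *-subalgebra of B × B, so (f(k), f(k + j)) does too. Since f(k + j) = 0, this puts f(k) in both
  -- K and J.
  have hmem : cfcₙ f ((k, k + j) : B × B) ∈ congruencePairs J K h :=
    cfcₙ_mem (hs := hcl) f ⟨hk, by simpa using neg_mem hj⟩
  have hsa : IsSelfAdjoint ((k, k + j) : B × B) := Prod.ext hks hkj
  rw [cfcₙ_map_prod (S := ℂ) f k (k + j) hf.continuousOn hsa hks hkj, hfkj] at hmem
  refine ⟨cfcₙ f k, by simpa using hmem.2, hmem.1, ?_⟩
  rw [hsub]
  exact norm_cfcₙ_le fun t _ => abs_realClip_le hε0 t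

/-- If `J` and `K` are C*-subalgebras with `K J ⊆ J`, then `J + K` is closed. -/
theorem isClosed_sup_of_mul_mem {J K : NonUnitalStarSubalgebra ℂ B}
    (hJ : IsClosed (J : Set B)) (hK : IsClosed (K : Set B)) (h : ∀ k ∈ K, ∀ j ∈ J, k * j ∈ J) :
    IsClosed ((J.toSubmodule ⊔ K.toSubmodule : Submodule ℂ B) : Set B) := by
  have : CompleteSpace J.toSubmodule := hJ.completeSpace_coe
  have : CompleteSpace K.toSubmodule := hK.completeSpace_coe
  -- Moving an element of J ∩ K from one summand to the other leaves the sum unchanged and makes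
  -- both summands small compared with it.
  have key : ∀ k ∈ K, ∀ j ∈ J, IsSelfAdjoint k → IsSelfAdjoint j →
      ∃ k' ∈ K, ∃ j' ∈ J, j' + k' = j + k ∧ ‖k'‖ ≤ ‖j + k‖ ∧ ‖j'‖ ≤ 2 * ‖j + k‖ := by
    intro k hk j hj hks hjs
    obtain ⟨l, hl, hl', hn⟩ := exists_mem_inf_norm_sub_le hJ hK h hk hj hks hjs
    rw [add_comm] at hn
    refine ⟨k - l, sub_mem hk hl', j + l, add_mem hj hl, by abel, hn, ?_⟩
    calc ‖j + l‖ = ‖(j + k) - (k - l)‖ := by congr 1; abel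
      _ ≤ ‖j + k‖ + ‖k - l‖ := norm_sub_le _ _
      _ ≤ _ := by linarith
  let g : (J.toSubmodule × K.toSubmodule) →L[ℂ] B :=
    J.toSubmodule.subtypeL.coprod K.toSubmodule.subtypeL
  let G : NormedAddGroupHom (J.toSubmodule × K.toSubmodule) B :=
    g.toLinearMap.toAddMonoidHom.mkNormedAddGroupHom ‖g‖ g.le_opNorm
  have hG : ∀ z, G z = (z.1 : B) + (z.2 : B) := fun z => rfl
  -- The constant is 4 = 2 + 2: the J-summands of the real and of the imaginary part each cost at
  -- most 2‖j + k‖.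
  have hs : G.SurjectiveOnWith (J.toSubmodule ⊔ K.toSubmodule).toAddSubgroup 4 := by
    intro b hb
    obtain ⟨j, hj, k, hk, rfl⟩ := Submodule.mem_sup.1 hb
    have hre : ∀ {S : NonUnitalStarSubalgebra ℂ B} {x : B}, x ∈ S →
        (realPart x : B) ∈ S ∧ (imaginaryPart x : B) ∈ S := by
      intro S x hx
      constructor
      · rw [realPart_apply_coe]
        rw [← Complex.coe_smul]
        exact SMulMemClass.smul_mem _ (add_mem hx (star_mem hx))
      · rw [imaginaryPart_apply_coe]
        rw [← Complex.coe_smul]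
        exact SMulMemClass.smul_mem _ (SMulMemClass.smul_mem _ (sub_mem hx (star_mem hx)))
    obtain ⟨k₁, hk₁, j₁, hj₁, e₁, n₁, m₁⟩ := key _ (hre hk).1 _ (hre hj).1 (realPart k).2
      (realPart j).2
    obtain ⟨k₂, hk₂, j₂, hj₂, e₂, n₂, m₂⟩ := key _ (hre hk).2 _ (hre hj).2 (imaginaryPart k).2
      (imaginaryPart j).2
    have r₁ : ‖(realPart j : B) + (realPart k : B)‖ ≤ ‖j + k‖ := by
      rw [← AddSubgroup.coe_add, ← map_add]
      exact realPart.norm_le (j + k)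
    have r₂ : ‖(imaginaryPart j : B) + (imaginaryPart k : B)‖ ≤ ‖j + k‖ := by
      rw [← AddSubgroup.coe_add, ← map_add]
      exact imaginaryPart.norm_le (j + k)
    refine ⟨(⟨j₁ + Complex.I • j₂, add_mem hj₁ (SMulMemClass.smul_mem _ hj₂)⟩,
      ⟨k₁ + Complex.I • k₂, add_mem hk₁ (SMulMemClass.smul_mem _ hk₂)⟩), ?_, ?_⟩
    · rw [hG]
      calc (j₁ + Complex.I • j₂) + (k₁ + Complex.I • k₂)
          = (j₁ + k₁) + Complex.I • (j₂ + k₂) := by rw [smul_add]; abel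
        _ = j + k := by
          rw [e₁, e₂, ← AddSubgroup.coe_add, ← AddSubgroup.coe_add, ← map_add, ← map_add,
            realPart_add_I_smul_imaginaryPart]
    · refine max_le ?_ ?_
      · refine (norm_add_le _ _).trans ?_
        rw [norm_smul, Complex.norm_I, one_mul]
        linarith
      · refine (norm_add_le _ _).trans ?_
        rw [norm_smul, Complex.norm_I, one_mul]
        linarith [norm_nonneg (j + k)]
  -- By successive approximation in the complete space J × K, norm-controlled preimages on J + K
  -- give preimages on its closure.
  have := controlled_closure_of_complete (by norm_num) one_pos hs
  rw [← closure_subset_iff_isClosed]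
  intro b hb
  obtain ⟨z, hz, -⟩ := this b hb
  rw [← hz]
  exact Submodule.add_mem_sup z.1.2 z.2.2

end SumClosed

/-! ### Evaluation of adjointable operators at a vector -/

theorem Adjointable.continuous_op_apply {A : Type*} [NonUnitalCStarAlgebra A] {E : Type*}
    [NormedAddCommGroup E] [NormedSpace ℂ E] [RightHilbertModule A E] (ζ : E) :
    Continuous fun S : Adjointable A E => S.op ζ :=
  AddMonoidHomClass.continuous_of_bound
    (AddMonoidHom.mk' (fun S : Adjointable A E => S.op ζ) fun _ _ => rfl) ‖ζ‖ fun S => by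
      rw [mul_comm]; exact S.op.le_opNorm ζ

theorem Adjointable.sum_op_apply {A : Type*} [NonUnitalCStarAlgebra A] {E : Type*}
    [NormedAddCommGroup E] [NormedSpace ℂ E] [RightHilbertModule A E] {α : Type*} (s : Finset α)
    (T : α → Adjointable A E) (ζ : E) : (∑ i ∈ s, T i).op ζ = ∑ i ∈ s, (T i).op ζ :=
  map_sum (AddMonoidHom.mk' (fun S : Adjointable A E => S.op ζ) fun _ _ => rfl) _ _

/-! ### The action of the core on the submodules ψ_r(X_r I_{q-r}) -/

namespace ProductSystem

variable {ι : Type*} {A : Type*} [NonUnitalCStarAlgebra A] (X : ProductSystem ι A)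

theorem rsmul_mem_fibIdeal {r n : ι →₀ ℕ} {ξ : X.fib r} (hξ : ξ ∈ X.fibIdeal r n) (a : A) :
    rsmul ξ a ∈ X.fibIdeal r n :=
  (rsmul (⟨ξ, hξ⟩ : X.fibIdeal r n) a).2

/-- If `ξ ∈ X_r I_n` and `0 < d ≤ n`, then `ι_r^{r + d}(θ_{ξ, ξ}) = 0`. -/
theorem iota_rankOne_eq_zero {r d s n : ι →₀ ℕ} (h : r ≤ s) (hd : r + d = s) (hd0 : 0 < d)
    (hdn : d ≤ n) {ξ : X.fib r} (hξ : ξ ∈ X.fibIdeal r n) : X.iota h (rankOne A ξ ξ) = 0 := by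
  -- On products, the operator gives (ξ⟨ξ, ζ⟩) η. The left factor is still in X_r I_n, and such
  -- vectors annihilate X_d because 0 < d ≤ n.
  have key : ∀ ζ η, (X.iota h (rankOne A ξ ξ)).op (X.mul hd ζ η) = 0 := fun ζ η => by
    rw [X.iota_mul h hd (rankOne_mem ξ ξ), rankOne_op]
    exact X.mul_eq_zero_of_mem (X.rsmul_mem_fibIdeal hξ _) hd0 hdn hd η
  -- For r = 0 the products need not span a dense subspace, since the left action of A may be
  -- degenerate. There θ_{ξ,ξ} is left multiplication by a a*, and φ_d(a) = 0 is checked directly.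
  by_cases h0 : r = 0
  · subst h0
    obtain rfl : d = s := by simpa using hd
    obtain ⟨a, rfl⟩ := X.unit_surj ξ
    have hs : rankOne A (X.unit a) (X.unit a) = X.lact 0 (a * star a) := ext' fun z => by
      obtain ⟨c, rfl⟩ := X.unit_surj z
      rw [rankOne_op, X.ip_unit, X.rsmul_unit, X.lact_unit, mul_assoc]
    have ha : X.lact d a = 0 := ext' fun η => by
      have := X.mul_eq_zero_of_mem hξ hd0 hdn hd η
      rw [X.unit_mul] at this
      rw [this]; rfl
    rw [hs, X.iota_lact, map_mul, ha, zero_mul]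
  · exact X.ext_mul hd h0 hd0.ne' fun ζ η => by rw [key]; rfl

variable {X}

namespace Rep

variable {B : Type*} [NonUnitalCStarAlgebra B] (ψ : Rep X B)

theorem compacts_dense_induction {n : ι →₀ ℕ} {p : compacts A (X.fib n) → Prop}
    (hc : IsClosed {S | p S}) (h0 : p 0) (hadd : ∀ S T, p S → p T → p (S + T))
    (hsmul : ∀ (c : ℂ) T, p T → p (c • T))
    (h1 : ∀ ξ η, p ⟨rankOne A ξ η, rankOne_mem ξ η⟩) (S : compacts A (X.fib n)) : p S := by
  refine (denseRange_thetaComb (X := X) n).induction_on S hc fun t => ?_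
  induction t using Finsupp.induction_linear with
  | zero => simpa using h0
  | add s t hs ht => rw [map_add]; exact hadd _ _ hs ht
  | single q c => simpa [thetaComb] using hsmul c _ (h1 q.1 q.2)

theorem continuous_map (n : ι →₀ ℕ) : Continuous (ψ.map n) :=
  AddMonoidHomClass.continuous_of_bound (ψ.map n) 1 fun ξ => by
    simpa using ψ.norm_map_le ξ

theorem onCompacts_thetaComb {n : ι →₀ ℕ} (t : X.fib n × X.fib n →₀ ℂ) :
    ψ.onCompacts n (thetaComb X n t) = ψ.psiComb n t :=
  LinearMap.extendOfNorm_eq (f := ψ.psiComb n) (denseRange_thetaComb (X := X) n)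
    ⟨1, fun t => by simpa using ψ.norm_psiComb_le n t⟩ t

theorem norm_onCompacts_le {n : ι →₀ ℕ} (S : compacts A (X.fib n)) :
    ‖ψ.onCompacts n S‖ ≤ ‖S‖ := by
  refine (denseRange_thetaComb (X := X) n).induction_on S
    (isClosed_le (ψ.onCompacts n).continuous.norm continuous_norm) fun t => ?_
  rw [onCompacts_thetaComb]
  exact ψ.norm_psiComb_le n t

/-- Both sides are linear and continuous in S, and for rank-one operators ψ_n(ξ) ψ_n(η)* ψ_n(ζ) =
ψ_n(ξ⟨η, ζ⟩). -/
theorem onCompacts_mul_map {n : ι →₀ ℕ} (S : compacts A (X.fib n)) (ζ : X.fib n) :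
    ψ.onCompacts n S * ψ.map n ζ = ψ.map n (S.1.op ζ) := by
  refine (denseRange_thetaComb (X := X) n).induction_on S
    (isClosed_eq ((ψ.onCompacts n).continuous.mul continuous_const)
      ((ψ.continuous_map n).comp ((continuous_op_apply ζ).comp continuous_subtype_val)))
    fun t => ?_
  rw [onCompacts_thetaComb, psiComb_mul_map]

theorem star_onCompacts {n : ι →₀ ℕ} (S : compacts A (X.fib n)) :
    star (ψ.onCompacts n S) = ψ.onCompacts n ⟨star S.1, star_mem_compacts S.2⟩ := by
  refine compacts_dense_induction (p := fun S => star (ψ.onCompacts n S) =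
    ψ.onCompacts n ⟨star S.1, star_mem_compacts S.2⟩) ?_ ?_ ?_ ?_ ?_ S
  · exact isClosed_eq (ψ.onCompacts n).continuous.star
      ((ψ.onCompacts n).continuous.comp (continuous_subtype_val.star.subtype_mk _))
  · have : (⟨star (0 : compacts A (X.fib n)).1, star_mem_compacts (zero_mem _)⟩ :
        compacts A (X.fib n)) = 0 := Subtype.ext (star_zero _)
    rw [this, map_zero, star_zero]
  · intro S T hS hT
    rw [map_add, star_add, hS, hT, ← map_add]
    exact congrArg _ (Subtype.ext (star_add S.1 T.1).symm)
  · intro c T hT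
    rw [map_smul, star_smul, hT, ← map_smul]
    exact congrArg _ (Subtype.ext (star_smul c T.1).symm)
  · intro ξ η
    rw [onCompacts_rankOne, star_mul, star_star]
    exact (ψ.onCompacts_rankOne η ξ).symm

variable {ψ}

theorem IsInjective.zeroHom_injective (hinj : ψ.IsInjective) : Function.Injective ψ.zeroHom :=
  fun _ _ h => X.unit.injective (hinj h)

/-- By the C*-identity, the norm of ψ_n(ξ) is read off from ψ_0(⟨ξ, ξ⟩), and an injective
*-homomorphism between C*-algebras is isometric. -/
theorem IsInjective.norm_map (hinj : ψ.IsInjective) {n : ι →₀ ℕ} (ξ : X.fib n) :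
    ‖ψ.map n ξ‖ = ‖ξ‖ := by
  have h : ‖ψ.map n ξ‖ ^ 2 = ‖ξ‖ ^ 2 := by
    rw [norm_sq_eq (A := A) ξ, sq, ← CStarRing.norm_star_mul_self, ψ.map_ip]
    exact NonUnitalStarAlgHom.norm_map ψ.zeroHom hinj.zeroHom_injective _
  exact (sq_eq_sq₀ (norm_nonneg _) (norm_nonneg _)).1 h

/-- Left multiplication by ψ^{(n)}(S) on ψ_n(X_n) is S itself, transported by the isometry ψ_n, so
its norm cannot drop below the operator norm of S. -/
theorem IsInjective.norm_onCompacts (hinj : ψ.IsInjective) {n : ι →₀ ℕ}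
    (S : compacts A (X.fib n)) : ‖ψ.onCompacts n S‖ = ‖S‖ := by
  refine le_antisymm (ψ.norm_onCompacts_le S)
    (ContinuousLinearMap.opNorm_le_bound _ (norm_nonneg _) fun ζ => ?_)
  change ‖S.1.op ζ‖ ≤ _
  rw [← hinj.norm_map (S.1.op ζ), ← hinj.norm_map ζ, ← onCompacts_mul_map]
  exact _root_.norm_mul_le _ _

/-- The range of ψ_0 is closed and contains the images of rank-one operators, so ψ^{(0)}(S) = ψ_0(b)
for some b. Acting on ψ_0(A), it gives b c = a c for all c in A, and c = (b - a)* then forces b = a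
even without a unit. -/
theorem IsInjective.onCompacts_lact (hinj : ψ.IsInjective) (S : compacts A (X.fib 0)) {a : A}
    (hS : S.1 = X.lact 0 a) : ψ.onCompacts 0 S = ψ.map 0 (X.unit a) := by
  have hr : ψ.onCompacts 0 S ∈ Set.range ψ.zeroHom := by
    have hcl : IsClosed (Set.range ψ.zeroHom) :=
      (NonUnitalStarAlgHom.isometry ψ.zeroHom
        hinj.zeroHom_injective).isClosedEmbedding.isClosed_range
    refine compacts_dense_induction (p := fun S => ψ.onCompacts 0 S ∈ Set.range ψ.zeroHom)
      (hcl.preimage (ψ.onCompacts 0).continuous) ⟨0, by simp⟩ ?_ ?_ ?_ S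
    · rintro S T ⟨a, ha⟩ ⟨b, hb⟩
      exact ⟨a + b, by rw [map_add, map_add, ha, hb]⟩
    · rintro c T ⟨a, ha⟩
      exact ⟨c • a, by rw [map_smul, map_smul, ha]⟩
    · intro ξ η
      obtain ⟨a, rfl⟩ := X.unit_surj ξ
      obtain ⟨b, rfl⟩ := X.unit_surj η
      refine ⟨a * star b, ?_⟩
      rw [onCompacts_rankOne, _root_.map_mul, map_star]
      rfl
  obtain ⟨b, hb⟩ := hr
  have h1 : ∀ c, b * c = a * c := fun c => by
    apply hinj.zeroHom_injective
    rw [_root_.map_mul, _root_.map_mul, hb]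
    have := ψ.onCompacts_mul_map S (X.unit c)
    rw [hS, X.lact_unit] at this
    rw [← _root_.map_mul ψ.zeroHom a c]
    exact this
  have h2 : b - a = 0 := by
    rw [← CStarRing.mul_star_self_eq_zero_iff, sub_mul, h1, sub_self]
  rw [← hb, sub_eq_zero.1 h2]
  rfl

/-- `ψ^{(p)}(S) ψ_r(ξ) = ψ_r(ι_p^r(S) ξ)` for `p ≤ r`. -/
theorem IsInjective.onCompacts_mul_map_of_le (hinj : ψ.IsInjective) {p r : ι →₀ ℕ} (h : p ≤ r)
    (S : compacts A (X.fib p)) (ξ : X.fib r) :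
    ψ.onCompacts p S * ψ.map r ξ = ψ.map r ((X.iota h S.1).op ξ) := by
  -- Density of the products X_p X_{r-p} in X_r is available only when p and r - p are both nonzero,
  -- so the two extreme cases are treated separately.
  by_cases h0 : p = 0
  · subst h0
    obtain ⟨a, ha⟩ := X.exists_eq_lact S.2
    rw [hinj.onCompacts_lact S ha, ha, X.iota_lact, ψ.map_lact]
  by_cases h1 : p = r
  · subst h1
    rw [X.iota_self h S.2, onCompacts_mul_map]
  have hd0 : r - p ≠ 0 := fun h2 => h1 (le_antisymm h (tsub_eq_zero_iff_le.1 h2))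
  have he : p + (r - p) = r := add_tsub_cancel_of_le h
  refine (X.denseRange_mulT he h0 hd0).induction_on
    (p := fun ξ => ψ.onCompacts p S * ψ.map r ξ = ψ.map r ((X.iota h S.1).op ξ)) ξ
    (isClosed_eq (continuous_const.mul (ψ.continuous_map r))
      ((ψ.continuous_map r).comp (X.iota h S.1).op.continuous)) fun t => ?_
  induction t with
  | zero => simp
  | add s t hs ht => simp only [map_add, mul_add, hs, ht]
  | tmul ζ η =>
    rw [X.mulT_tmul, X.iota_mul h he S.2, ← ψ.map_mul, ← ψ.map_mul, ← mul_assoc,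
      onCompacts_mul_map]

/-- `ψ^{(p)}(S) ψ_r(ξ) = 0` if `p ≰ r` and `ξ ∈ X_r I_{q - r}`, where `q ≥ p, r`. -/
theorem IsNica.onCompacts_mul_map_eq_zero {hX : X.CompactlyAligned} (hN : ψ.IsNica hX)
    {p r q : ι →₀ ℕ} (hp : p ≤ q) (hr : r ≤ q) (hpr : ¬ p ≤ r) (S : compacts A (X.fib p))
    {ξ : X.fib r} (hξ : ξ ∈ X.fibIdeal r (q - r)) : ψ.onCompacts p S * ψ.map r ξ = 0 := by
  have hd : r + (p ⊔ r - r) = p ⊔ r := add_tsub_cancel_of_le le_sup_right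
  -- The difference d = (p ∨ r) - r is nonzero exactly because p ≰ r, and d ≤ q - r because p and r
  -- lie below q. So I_{q-r} is contained in the kernel of φ_d.
  have hd0 : 0 < p ⊔ r - r := pos_of_ne_zero fun h =>
    hpr (le_sup_left.trans (tsub_eq_zero_iff_le.1 h))
  have hdn : p ⊔ r - r ≤ q - r := tsub_le_tsub_right (sup_le hp hr) r
  -- Nica covariance turns ψ^{(p)}(S) ψ_r(ξ) ψ_r(ξ)* into the image of a product with the factor
  -- ι_r^{p∨r}(θ_{ξ,ξ}), which is zero.
  have h1 := hN p r S ⟨rankOne A ξ ξ, rankOne_mem ξ ξ⟩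
  have h2 : (⟨_, hX p r S.1 S.2 (rankOne A ξ ξ) (rankOne_mem ξ ξ)⟩ :
      compacts A (X.fib (p ⊔ r))) = 0 := Subtype.ext <| by
    change _ * X.iota _ (rankOne A ξ ξ) = 0
    rw [X.iota_rankOne_eq_zero _ hd hd0 hdn hξ, mul_zero]
  rw [h2, map_zero, onCompacts_rankOne] at h1
  -- For b = ψ^{(p)}(S) ψ_r(ξ), the product just shown to vanish is a left factor of b b*.
  rw [← CStarRing.mul_star_self_eq_zero_iff, star_mul]
  calc _ = ψ.onCompacts p S * (ψ.map r ξ * star (ψ.map r ξ)) * star (ψ.onCompacts p S) := by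
        simp only [mul_assoc]
    _ = 0 := by rw [h1, zero_mul]

/-- This explains the form of ι̃: the component of ι̃_p^q(S) at r, including the value 0 for p ≰ r,
is what left multiplication by ψ^{(p)}(S) does on ψ_r(X_r I_{q-r}). -/
theorem IsInjective.onCompacts_mul_map_fibIdeal (hinj : ψ.IsInjective) {hX : X.CompactlyAligned}
    (hN : ψ.IsNica hX) {p r q : ι →₀ ℕ} (hp : p ≤ q) (hr : r ≤ q) (S : compacts A (X.fib p))
    (ξ : X.fibIdeal r (q - r)) : ψ.onCompacts p S * ψ.map r (ξ : X.fib r) =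
      ψ.map r ((X.iotaComp p r (q - r) S).op ξ : X.fibIdeal r (q - r)) := by
  unfold iotaComp
  split_ifs with h
  · exact hinj.onCompacts_mul_map_of_le h S ξ
  · rw [hN.onCompacts_mul_map_eq_zero hp hr h S ξ.2]
    simp

/-- The element `∑_{p ∈ F} ψ^{(p)}(S_p)`. -/
noncomputable def sumOver (ψ : Rep X B) (F : Finset (ι →₀ ℕ)) :
    (∀ p : F, compacts A (X.fib p)) →ₗ[ℂ] B :=
  ∑ p : F, (ψ.onCompacts p).toLinearMap ∘ₗ LinearMap.proj p

theorem sumOver_apply (F : Finset (ι →₀ ℕ)) (S : ∀ p : F, compacts A (X.fib p)) :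
    ψ.sumOver F S = ∑ p : F, ψ.onCompacts p (S p) := by
  simp only [sumOver, LinearMap.sum_apply]
  rfl

/-- The operator on the left is left multiplication by the element on the right, restricted to the
isometric copy ψ_r(X_r I_{q-r}) of X_r I_{q-r}. -/
theorem IsInjective.norm_sum_iotaComp_le (hinj : ψ.IsInjective) {hX : X.CompactlyAligned}
    (hN : ψ.IsNica hX) {n r q : ι →₀ ℕ} (hn : n ≤ q) (hr : r ≤ q)
    (S : ∀ p : below n, compacts A (X.fib p)) :
    ‖∑ p : below n, X.iotaComp p r (q - r) (S p)‖ ≤ ‖ψ.sumOver (below n) S‖ := by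
  refine ContinuousLinearMap.opNorm_le_bound _ (norm_nonneg _) fun ξ => ?_
  have h2 : ψ.sumOver (below n) S * ψ.map r (ξ : X.fib r) =
      ψ.map r ((∑ p : below n, X.iotaComp p r (q - r) (S p)).op ξ : X.fibIdeal r (q - r)) := by
    rw [sum_op_apply, sumOver_apply, Finset.sum_mul, Submodule.coe_sum, map_sum]
    exact Finset.sum_congr rfl fun p _ =>
      hinj.onCompacts_mul_map_fibIdeal hN ((below_mem n p).trans hn) hr (S p) ξ
  generalize (∑ p : below n, X.iotaComp p r (q - r) (S p)) = T at h2
  calc ‖T.op ξ‖ = ‖ψ.sumOver (below n) S * ψ.map r (ξ : X.fib r)‖ := by rw [h2, hinj.norm_map]; rfl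
    _ ≤ ‖ψ.sumOver (below n) S‖ * ‖ψ.map r (ξ : X.fib r)‖ := _root_.norm_mul_le _ _
    _ = ‖ψ.sumOver (below n) S‖ * ‖ξ‖ := by rw [hinj.norm_map]; rfl

theorem IsInjective.norm_sum_iotaTilde_le (hinj : ψ.IsInjective) {hX : X.CompactlyAligned}
    (hN : ψ.IsNica hX) {n q : ι →₀ ℕ} (hn : n ≤ q) (S : ∀ p : below n, compacts A (X.fib p)) :
    ‖∑ p : below n, X.iotaTilde p q (S p)‖ ≤ ‖ψ.sumOver (below n) S‖ := by
  refine (pi_norm_le_iff_of_nonneg (norm_nonneg _)).2 fun r => ?_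
  have e : (∑ p : below n, X.iotaTilde p q (S p)) r =
      ∑ p : below n, X.iotaComp p r (q - r) (S p) :=
    map_sum (AddMonoidHom.mk' (fun x : X.OpSum q => x r) fun _ _ => rfl) _ _
  exact (congrArg norm e).le.trans (hinj.norm_sum_iotaComp_le hN hn (below_mem q r) S)

/-- Supremum over all r ≤ q and q ≥ n of the previous estimates. Only Nica covariance and
injectivity of ψ enter. It says that passing from a sum in B back to its family is well defined and
contractive. -/
theorem IsInjective.norm_family_le (hinj : ψ.IsInjective) {hX : X.CompactlyAligned}
    (hN : ψ.IsNica hX) (n : ι →₀ ℕ) (S : ∀ p : below n, compacts A (X.fib p)) :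
    ‖X.family n S‖ ≤ ‖ψ.sumOver (below n) S‖ := by
  refine lp.norm_le_of_forall_le (norm_nonneg _) fun q => ?_
  change ‖X.comp q (X.family n S)‖ ≤ _
  rw [family_coe]
  exact hinj.norm_sum_iotaTilde_le hN q.2 S

end Rep

end ProductSystem

/-! ### Closedness of the finite levels of the core -/

namespace ProductSystem

variable {ι : Type*} {A : Type*} [NonUnitalCStarAlgebra A] {X : ProductSystem ι A}

open Classical in
theorem family_single {n p : ι →₀ ℕ} (hp : p ≤ n) (S : compacts A (X.fib p)) :
    X.family n (Pi.single (⟨p, mem_below.2 hp⟩ : below n) S) = X.tilde n p S := by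
  rw [family_apply, Finset.sum_eq_single (⟨p, mem_below.2 hp⟩ : below n)]
  · simp
  · intro b _ hb; simp [Pi.single_eq_of_ne hb]
  · simp

theorem tilde_mul (hX : X.CompactlyAligned) (n p p' : ι →₀ ℕ) (S : compacts A (X.fib p))
    (T : compacts A (X.fib p')) : X.tilde n p S * X.tilde n p' T =
      X.tilde n (p ⊔ p') ⟨_, hX p p' _ S.2 _ T.2⟩ :=
  OpProd.ext fun q => X.iotaTilde_mul hX p p' q S T

theorem star_tilde (n p : ι →₀ ℕ) (S : compacts A (X.fib p)) :
    star (X.tilde n p S) = X.tilde n p ⟨star S.1, star_mem_compacts S.2⟩ :=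
  OpProd.ext fun q => X.star_iotaTilde p q S

namespace Rep

variable {B : Type*} [NonUnitalCStarAlgebra B] {ψ : Rep X B}

open Classical in
theorem sumOver_single {F : Finset (ι →₀ ℕ)} {p : ι →₀ ℕ} (hp : p ∈ F)
    (S : compacts A (X.fib p)) :
    ψ.sumOver F (Pi.single (⟨p, hp⟩ : F) S) = ψ.onCompacts p S := by
  rw [sumOver_apply, Finset.sum_eq_single (⟨p, hp⟩ : F)]
  · simp
  · intro b _ hb; simp [Pi.single_eq_of_ne hb]
  · simp

theorem onCompacts_mem_range {F : Finset (ι →₀ ℕ)} {p : ι →₀ ℕ} (hp : p ∈ F)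
    (S : compacts A (X.fib p)) : ψ.onCompacts p S ∈ LinearMap.range (ψ.sumOver F) :=
  ⟨_, sumOver_single hp S⟩

/-- The *-algebra `∑_{p ∈ F} ψ^{(p)}(𝓚(X_p))` for a finite set `F` that is closed under joins. -/
noncomputable def level {hX : X.CompactlyAligned} (hN : ψ.IsNica hX) (F : Finset (ι →₀ ℕ))
    (hF : SupClosed (F : Set (ι →₀ ℕ))) : NonUnitalStarSubalgebra ℂ B where
  __ := LinearMap.range (ψ.sumOver F)
  mul_mem' := by
    rintro _ _ ⟨S, rfl⟩ ⟨T, rfl⟩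
    change _ ∈ LinearMap.range (ψ.sumOver F)
    rw [sumOver_apply, sumOver_apply, Finset.sum_mul_sum]
    refine sum_mem fun p _ => sum_mem fun p' _ => ?_
    rw [hN]
    exact onCompacts_mem_range (hF p.2 p'.2) _
  star_mem' := by
    rintro _ ⟨S, rfl⟩
    change _ ∈ LinearMap.range (ψ.sumOver F)
    rw [sumOver_apply, star_sum]
    refine sum_mem fun p _ => ?_
    rw [star_onCompacts]
    exact onCompacts_mem_range p.2 _

theorem range_sumOver_le {F : Finset (ι →₀ ℕ)} {M : Submodule ℂ B}
    (h : ∀ p ∈ F, ∀ S, ψ.onCompacts p S ∈ M) : LinearMap.range (ψ.sumOver F) ≤ M := by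
  rintro _ ⟨S, rfl⟩
  rw [sumOver_apply]
  exact sum_mem fun p _ => h p p.2 _

/-- The space 𝓚(X_p) is complete and ψ^{(p)} is isometric. -/
theorem IsInjective.isClosed_range_singleton (hinj : ψ.IsInjective) (p : ι →₀ ℕ) :
    IsClosed (LinearMap.range (ψ.sumOver {p}) : Set B) := by
  have h : (LinearMap.range (ψ.sumOver {p}) : Set B) = Set.range (ψ.onCompacts p) := by
    refine subset_antisymm ?_ ?_
    · refine range_sumOver_le (M := LinearMap.range (ψ.onCompacts p).toLinearMap) fun q hq S => ?_
      obtain rfl := Finset.mem_singleton.1 hq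
      exact ⟨S, rfl⟩
    · rintro _ ⟨S, rfl⟩
      exact onCompacts_mem_range (Finset.mem_singleton_self p) S
  rw [h]
  have : CompleteSpace (compacts A (X.fib p)) := isClosed_compacts.completeSpace_coe
  exact (AddMonoidHomClass.isometry_of_norm (ψ.onCompacts p)
    hinj.norm_onCompacts).isClosedEmbedding.isClosed_range

/-- `∑_{p ∈ F} ψ^{(p)}(𝓚(X_p))` is closed. -/
theorem IsInjective.isClosed_range_sumOver (hinj : ψ.IsInjective) {hX : X.CompactlyAligned}
    (hN : ψ.IsNica hX) (F : Finset (ι →₀ ℕ)) (hF : SupClosed (F : Set (ι →₀ ℕ))) :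
    IsClosed (LinearMap.range (ψ.sumOver F) : Set B) := by
  classical
  induction F using Finset.strongInduction with
  | H F ih =>
    rcases F.eq_empty_or_nonempty with rfl | hne
    · have : LinearMap.range (ψ.sumOver ∅) = ⊥ :=
        le_bot_iff.1 (range_sumOver_le fun p hp => absurd hp (Finset.notMem_empty p))
      rw [this]
      exact isClosed_singleton
    -- A minimal p is never the join of two elements of F unless both equal p. So F without p is
    -- still closed under joins, and joining p with another element of F stays in F without p.
    · obtain ⟨p, hp⟩ := F.exists_minimal hne
      have hmin : ∀ q ∈ F, q ≤ p → q = p := fun q hq h => le_antisymm h (hp.2 hq h)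
      have hE : SupClosed ((F.erase p : Finset (ι →₀ ℕ)) : Set (ι →₀ ℕ)) := by
        intro a ha b hb
        rw [Finset.mem_coe, Finset.mem_erase] at ha hb ⊢
        exact ⟨fun h => ha.1 (hmin a ha.2 (le_sup_left.trans h.le)), hF ha.2 hb.2⟩
      have hS : SupClosed (({p} : Finset (ι →₀ ℕ)) : Set (ι →₀ ℕ)) := by
        rw [Finset.coe_singleton]; exact supClosed_singleton
      -- The absorbing summand J comes from F without p and is closed by induction. The summand K is
      -- ψ^{(p)}(𝓚(X_p)).
      have hcl := isClosed_sup_of_mul_mem (J := level hN _ hE) (K := level hN _ hS)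
        (ih _ (Finset.erase_ssubset hp.1) hE) (hinj.isClosed_range_singleton p) ?_
      · convert hcl
        refine le_antisymm (range_sumOver_le fun q hq S => ?_) (sup_le
          (range_sumOver_le fun q hq S => onCompacts_mem_range (Finset.mem_of_mem_erase hq) S)
          (range_sumOver_le fun q hq S => onCompacts_mem_range
            (Finset.mem_singleton.1 hq ▸ hp.1) S))
        by_cases h : q = p
        · subst h
          exact Submodule.mem_sup_right (onCompacts_mem_range (Finset.mem_singleton_self q) S)
        · exact Submodule.mem_sup_left (onCompacts_mem_range (Finset.mem_erase.2 ⟨h, hq⟩) S)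
      · rintro _ ⟨S, rfl⟩ _ ⟨T, rfl⟩
        change _ ∈ LinearMap.range (ψ.sumOver (F.erase p))
        rw [sumOver_apply, sumOver_apply, Finset.sum_mul_sum]
        refine sum_mem fun q _ => sum_mem fun q' _ => ?_
        rw [hN]
        have hq := Finset.mem_singleton.1 q.2
        have hq' := Finset.mem_erase.1 q'.2
        -- If the join of p and q' were p, then q' ≤ p, and minimality would give q' = p.
        refine onCompacts_mem_range (Finset.mem_erase.2 ⟨fun h => hq'.1 (hmin _ hq'.2 ?_), ?_⟩) _
        · exact le_sup_right.trans h.le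
        · exact hF (show (q : ι →₀ ℕ) ∈ F by rw [hq]; exact hp.1) hq'.2

/-! ### The C*-algebra of pairs and the maps κ̃_n -/

variable (ψ) in
/-- The pairs `((∑_{p ≤ n} ι̃_p^q(S_p))_{q ≥ n}, ∑_{p ≤ n} ψ^{(p)}(S_p))`. -/
noncomputable def pairs (n : ι →₀ ℕ) : Submodule ℂ (X.OpProd n × B) :=
  LinearMap.range ((X.family n).prod (ψ.sumOver (below n)))

theorem tilde_onCompacts_mem_pairs {n p : ι →₀ ℕ} (hp : p ≤ n) (S : compacts A (X.fib p)) :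
    (X.tilde n p S, ψ.onCompacts p S) ∈ ψ.pairs n := by
  classical
  exact ⟨Pi.single (⟨p, mem_below.2 hp⟩ : below n) S,
    Prod.ext (family_single hp S) (sumOver_single (mem_below.2 hp) S)⟩

theorem prod_eq_sum (n : ι →₀ ℕ) (S : ∀ p : below n, compacts A (X.fib p)) :
    ((X.family n).prod (ψ.sumOver (below n))) S =
      ∑ p : below n, ((X.tilde n p (S p), ψ.onCompacts p (S p)) : X.OpProd n × B) :=
  Prod.ext (by rw [Prod.fst_sum]; exact family_apply X n S)
    (by rw [Prod.snd_sum]; exact sumOver_apply _ S)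

/-- A sum over p ≤ n is also a sum over p ≤ m with the same summands. This is the compatibility of
the κ̃_n with the connecting maps at the level of pairs. -/
theorem tail_mem_pairs {n m : ι →₀ ℕ} (h : n ≤ m) (S : ∀ p : below n, compacts A (X.fib p)) :
    (X.tail h (X.family n S), ψ.sumOver (below n) S) ∈ ψ.pairs m := by
  have e : ((X.tail h (X.family n S), ψ.sumOver (below n) S) : X.OpProd m × B) =
      ∑ p : below n, ((X.tilde m p (S p), ψ.onCompacts p (S p)) : X.OpProd m × B) :=
    Prod.ext (by rw [Prod.fst_sum, family_apply, map_sum]; rfl)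
      (by rw [Prod.snd_sum]; exact sumOver_apply _ S)
  rw [e]
  exact sum_mem fun p _ => tilde_onCompacts_mem_pairs ((below_mem n p).trans h) _

/-- `pairs` as a *-algebra. -/
noncomputable def pairsAlg {hX : X.CompactlyAligned} (hN : ψ.IsNica hX) (n : ι →₀ ℕ) :
    NonUnitalStarSubalgebra ℂ (X.OpProd n × B) where
  __ := ψ.pairs n
  mul_mem' := by
    rintro _ _ ⟨S, rfl⟩ ⟨T, rfl⟩
    change _ ∈ ψ.pairs n
    rw [prod_eq_sum, prod_eq_sum, Finset.sum_mul_sum]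
    refine sum_mem fun p _ => sum_mem fun p' _ => ?_
    rw [Prod.mk_mul_mk, hN, tilde_mul hX]
    exact tilde_onCompacts_mem_pairs (sup_le (below_mem n p) (below_mem n p')) _
  star_mem' := by
    rintro _ ⟨S, rfl⟩
    change _ ∈ ψ.pairs n
    rw [prod_eq_sum, star_sum]
    refine sum_mem fun p _ => ?_
    rw [Prod.star_def, star_onCompacts, star_tilde]
    exact tilde_onCompacts_mem_pairs (below_mem n p) _

theorem IsInjective.norm_fst_le (hinj : ψ.IsInjective) {hX : X.CompactlyAligned}
    (hN : ψ.IsNica hX) {n : ι →₀ ℕ} {z : X.OpProd n × B} (hz : z ∈ ψ.pairs n) :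
    ‖z.1‖ ≤ ‖z.2‖ := by
  obtain ⟨S, rfl⟩ := hz
  exact hinj.norm_family_le hN n S

theorem IsInjective.norm_fst_sub_le (hinj : ψ.IsInjective) {hX : X.CompactlyAligned}
    (hN : ψ.IsNica hX) {n : ι →₀ ℕ} {x y : X.OpProd n} {b c : B} (hx : (x, b) ∈ ψ.pairs n)
    (hy : (y, c) ∈ ψ.pairs n) : ‖x - y‖ ≤ ‖b - c‖ := by
  obtain ⟨S, hS⟩ := hx
  obtain ⟨T, hT⟩ := hy
  obtain ⟨rfl, rfl⟩ := Prod.mk.inj hS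
  obtain ⟨rfl, rfl⟩ := Prod.mk.inj hT
  rw [← map_sub, ← map_sub]
  exact hinj.norm_family_le hN n _

/-- A closed-graph argument: the second coordinates range over a closed space, and the first
coordinate depends contractively on the second. No closedness of C̃_n is needed. -/
theorem IsInjective.isClosed_pairs (hinj : ψ.IsInjective) {hX : X.CompactlyAligned}
    (hN : ψ.IsNica hX) (n : ι →₀ ℕ) : IsClosed (ψ.pairs n : Set (X.OpProd n × B)) := by
  refine IsSeqClosed.isClosed fun u z hu hz => ?_
  have hcl := hinj.isClosed_range_sumOver hN (below n) (fun a ha b hb =>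
    mem_below.2 (sup_le (mem_below.1 ha) (mem_below.1 hb)))
  have h1 := hz.fst_nhds
  have h2 := hz.snd_nhds
  obtain ⟨S, hS⟩ : z.2 ∈ LinearMap.range (ψ.sumOver (below n)) :=
    hcl.mem_of_tendsto h2 (Filter.Eventually.of_forall fun i => by
      obtain ⟨S, hS⟩ := hu i
      exact ⟨S, congrArg Prod.snd hS⟩)
  have hw : (X.family n S, z.2) ∈ ψ.pairs n := ⟨S, Prod.ext rfl hS⟩
  -- Convergence of the second coordinates forces the first ones to converge to the family of a
  -- tuple S that represents the limit z.2, so z.1 is this family.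
  have h3 : Filter.Tendsto (fun i => (u i).1) Filter.atTop (nhds (X.family n S)) := by
    rw [tendsto_iff_norm_sub_tendsto_zero] at h2 ⊢
    exact squeeze_zero (fun _ => norm_nonneg _)
      (fun i => hinj.norm_fst_sub_le hN (hu i) hw) h2
  rw [show z = (X.family n S, z.2) from Prod.ext (tendsto_nhds_unique h1 h3) rfl]
  exact hw

/-- The family is indexed by all q ≥ n, so given any m the sum of the ι̃_p^q(S_p) vanishes for all q
≥ m ∨ n. That is the vanishing for large q that CNP covariance asks for. -/
theorem IsCNP.sumOver_eq_zero {hX : X.CompactlyAligned} (hcnp : ψ.IsCNP hX) {n : ι →₀ ℕ}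
    {S : ∀ p : below n, compacts A (X.fib p)} (hS : X.family n S = 0) :
    ψ.sumOver (below n) S = 0 := by
  classical
  -- The covariance condition is stated for tuples indexed by all p. The values outside the finite
  -- set play no role and are set to 0.
  let T : ∀ p, compacts A (X.fib p) := fun p => if h : p ∈ below n then S ⟨p, h⟩ else 0
  have hT : ∀ p : below n, T p = S p := fun p => dif_pos p.2
  have := hcnp.2 (below n) T fun m => ⟨m ⊔ n, le_sup_left, fun q hq => by
    have h := X.family_coe n S ⟨q, le_sup_right.trans hq⟩
    rw [hS, map_zero] at h
    rw [← Finset.sum_coe_sort, h]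
    exact Finset.sum_congr rfl fun p _ => by rw [hT]⟩
  rw [← Finset.sum_coe_sort] at this
  rw [sumOver_apply, ← this]
  exact Finset.sum_congr rfl fun p _ => by rw [hT]

/-- This is the well-definedness of κ̃_n: the pairs form the graph of a function of the first
coordinate. -/
theorem IsCNP.snd_eq {hX : X.CompactlyAligned} (hcnp : ψ.IsCNP hX) {n : ι →₀ ℕ}
    {x : X.OpProd n} {b c : B} (hb : (x, b) ∈ ψ.pairs n) (hc : (x, c) ∈ ψ.pairs n) : b = c := by
  obtain ⟨S, hS⟩ := sub_mem hb hc
  have h1 : X.family n S = 0 := (congrArg Prod.fst hS).trans (sub_self x)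
  have h2 : ψ.sumOver (below n) S = b - c := congrArg Prod.snd hS
  rw [← sub_eq_zero, ← h2, hcnp.sumOver_eq_zero h1]

/-- The two projections of the C*-algebra of pairs are injective, hence isometric. -/
theorem IsCNP.norm_snd_eq {hX : X.CompactlyAligned} (hcnp : ψ.IsCNP hX) (hinj : ψ.IsInjective)
    {n : ι →₀ ℕ} {z : X.OpProd n × B} (hz : z ∈ ψ.pairs n) : ‖z.2‖ = ‖z.1‖ := by
  refine le_antisymm ?_ (hinj.norm_fst_le hcnp.1 hz)
  -- Completeness of the algebra of pairs is what makes an injective *-homomorphism out of it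
  -- automatically isometric.
  let : NonUnitalCStarAlgebra (pairsAlg hcnp.1 n) :=
    NonUnitalStarSubalgebra.nonUnitalCStarAlgebra _ (h_closed := hinj.isClosed_pairs hcnp.1 n)
  let φ : pairsAlg hcnp.1 n →⋆ₙₐ[ℂ] X.OpProd n :=
    (NonUnitalStarAlgHom.fst ℂ (X.OpProd n) B).comp
      (NonUnitalStarSubalgebraClass.subtype (pairsAlg hcnp.1 n))
  have hφ : Function.Injective φ := by
    rintro ⟨⟨x, b⟩, hb⟩ ⟨⟨y, c⟩, hc⟩ h
    obtain rfl : x = y := h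
    obtain rfl : b = c := hcnp.snd_eq hb hc
    rfl
  -- The norm of a pair is the maximum of the norms of its coordinates, so this already bounds the
  -- second coordinate by the first.
  have h : ‖z.1‖ = ‖z‖ := NonUnitalStarAlgHom.norm_map φ hφ ⟨z, hz⟩
  rw [h]
  exact norm_snd_le z

/-- The *-homomorphism `κ̃_n : C̃_n → B`. -/
theorem IsCNP.exists_kappa {hX : X.CompactlyAligned} (hcnp : ψ.IsCNP hX) (n : ι →₀ ℕ) :
    ∃ κ : Ctilde hX n →⋆ₙₐ[ℂ] B, ∀ x, (x.1, κ x) ∈ ψ.pairs n := by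
  have hex : ∀ x : Ctilde hX n, ∃ b, (x.1, b) ∈ ψ.pairs n := by
    rintro ⟨_, S, rfl⟩
    exact ⟨ψ.sumOver (below n) S, S, rfl⟩
  -- The function g has the pairs as its graph. Since the pairs form a *-algebra, uniqueness of the
  -- second coordinate turns each closure property into the corresponding homomorphism identity.
  choose g hg using hex
  exact ⟨{  toFun := g
            map_smul' := fun c x => hcnp.snd_eq (hg _) ((ψ.pairs n).smul_mem c (hg x))
            map_zero' := hcnp.snd_eq (hg _) (zero_mem (ψ.pairs n))
            map_add' := fun x y => hcnp.snd_eq (hg _) (add_mem (hg x) (hg y))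
            map_mul' := fun x y => hcnp.snd_eq (hg _)
              ((pairsAlg hcnp.1 n).mul_mem (hg x) (hg y))
            map_star' := fun x => hcnp.snd_eq (hg _) ((pairsAlg hcnp.1 n).star_mem' (hg x)) }, hg⟩

/-! ### The core as the closure of an increasing union -/

theorem onCompacts_mem_core {p : ι →₀ ℕ} (S : compacts A (X.fib p)) :
    ψ.onCompacts p S ∈ ψ.core := by
  refine compacts_dense_induction (p := fun S => ψ.onCompacts p S ∈ ψ.core)
    ((Submodule.isClosed_topologicalClosure _).preimage (ψ.onCompacts p).continuous)
    ?_ ?_ ?_ ?_ S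
  · rw [map_zero]; exact zero_mem _
  · intro S T hS hT; rw [map_add]; exact add_mem hS hT
  · intro c T hT; rw [map_smul]; exact Submodule.smul_mem _ c hT
  · intro ξ η
    rw [onCompacts_rankOne]
    exact Submodule.le_topologicalClosure _ (Submodule.subset_span ⟨p, ξ, η, rfl⟩)

/-- The core is the closure of the union of the algebras `∑_{p ≤ n} ψ^{(p)}(𝓚(X_p))`. -/
theorem core_eq_closure :
    (ψ.core : Set B) = closure (⋃ n, (LinearMap.range (ψ.sumOver (below n)) : Set B)) := by
  refine subset_antisymm (closure_mono ?_) (closure_minimal (Set.iUnion_subset fun n => ?_)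
    (Submodule.isClosed_topologicalClosure _))
  -- A directed union of subspaces is a subspace, so it contains the span of the ψ_n(ξ) ψ_n(η)* as
  -- soon as it contains each of them.
  · have hdir : Directed (· ≤ ·) fun n => LinearMap.range (ψ.sumOver (below n)) :=
      Monotone.directed_le fun n m h => range_sumOver_le fun p hp S =>
        onCompacts_mem_range (mem_below.2 ((mem_below.1 hp).trans h)) S
    rw [← Submodule.coe_iSup_of_directed _ hdir]
    refine Submodule.span_le.2 ?_
    rintro _ ⟨n, ξ, η, rfl⟩
    rw [← onCompacts_rankOne]
    exact Submodule.mem_iSup_of_mem n (onCompacts_mem_range (mem_below.2 le_rfl) _)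
  · exact range_sumOver_le fun p _ S => onCompacts_mem_core S

end Rep

end ProductSystem

/-! ### Lifting isometric cones to the inductive limit -/

namespace CStarLimit

open Topology

variable {I : Type*} [Preorder I] [IsDirectedOrder I] [Nonempty I] {G : I → Type*}
  [∀ i, NonUnitalNormedRing (G i)] [∀ i, StarRing (G i)] [∀ i, CStarRing (G i)]
  [∀ i, NormedSpace ℂ (G i)] [∀ i, IsScalarTower ℂ (G i) (G i)]
  [∀ i, SMulCommClass ℂ (G i) (G i)] [∀ i, StarModule ℂ (G i)]
  {f : ∀ i j, i ≤ j → G i →⋆ₙₐ[ℂ] G j} [ContractiveSystem G f]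
  {B : Type*} [NonUnitalCStarAlgebra B] (κ : ∀ i, G i →⋆ₙₐ[ℂ] B)

@[elab_as_elim]
theorem induction {p : CStarLimit G f → Prop} (x : CStarLimit G f) (hp : IsClosed {x | p x})
    (h : ∀ i x, p (of G f i x)) : p x :=
  CStarCompletion.induction_on x hp fun y => AlgLimit.induction (C := fun y => p (CStarCompletion.toLim _ y)) h y

theorem induction₂ {p : CStarLimit G f → CStarLimit G f → Prop} (x y : CStarLimit G f)
    (hp : IsClosed {z : CStarLimit G f × CStarLimit G f | p z.1 z.2})
    (h : ∀ i x y, p (of G f i x) (of G f i y)) : p x y :=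
  (CStarCompletion.denseRange (AlgLimit G f)).induction_on₂ hp
    (fun a b => AlgLimit.induction₂ (C := fun a b =>
      p (CStarCompletion.toLim _ a) (CStarCompletion.toLim _ b)) h a b) x y

/-- The linear map on the algebraic direct limit induced by a cone of *-homomorphisms. -/
def algLift (hκ : ∀ i j (h : i ≤ j) x, κ j (f i j h x) = κ i x) : AlgLimit G f →ₗ[ℂ] B where
  toFun := DirectLimit.lift f (fun i x => κ i x) fun i j h x => (hκ i j h x).symm
  map_add' x y := by
    induction x, y using AlgLimit.induction₂ with
    | ih i x y => rw [← map_add]; exact map_add (κ i) x y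
  map_smul' c x := by
    induction x using AlgLimit.induction with
    | ih i x => rw [← map_smul]; exact map_smul (κ i) c x

theorem algLift_of (hκ : ∀ i j (h : i ≤ j) x, κ j (f i j h x) = κ i x) (i : I) (x : G i) :
    algLift κ hκ (AlgLimit.of G f i x) = κ i x := rfl

variable {κ}

/-- The net ‖f_{ij}(x)‖ = ‖κ_j(f_{ij}(x))‖ = ‖κ_i(x)‖ is constant, so the limit seminorm of x is
‖κ_i(x)‖. -/
theorem norm_algLift (hκ : ∀ i j (h : i ≤ j) x, κ j (f i j h x) = κ i x)
    (hn : ∀ i x, ‖κ i x‖ = ‖x‖) (x : AlgLimit G f) : ‖algLift κ hκ x‖ = ‖x‖ := by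
  induction x using AlgLimit.induction with
  | ih i x =>
    rw [algLift_of, AlgLimit.norm_of]
    refine (AlgLimit.limNorm_eq_of f tendsto_const_nhds (k := i) fun j hj _ => ?_).symm
    rw [← hn, hκ]

/-- A cone of isometric *-homomorphisms induces a unique *-homomorphism on the inductive limit,
which is isometric. Its range is the smallest closed set that contains the ranges of the cone. -/
theorem exists_isometric_lift (hκ : ∀ i j (h : i ≤ j) x, κ j (f i j h x) = κ i x)
    (hn : ∀ i x, ‖κ i x‖ = ‖x‖) :
    ∃ κt : CStarLimit G f →⋆ₙₐ[ℂ] B, (∀ i x, κt (of G f i x) = κ i x) ∧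
      (∀ κ' : CStarLimit G f →⋆ₙₐ[ℂ] B, (∀ i x, κ' (of G f i x) = κ i x) → κ' = κt) ∧
      Isometry κt ∧ Set.range κt = closure (⋃ i, Set.range (κ i)) := by
  -- Extension by continuity along the dense map into the completion. Its kernel causes no trouble,
  -- because the lift preserves the limit seminorm.
  let L : CStarLimit G f →L[ℂ] B :=
    (algLift κ hκ).extendOfNorm (CStarCompletion.toLim (AlgLimit G f)).toLinearMap
  have hd : DenseRange (CStarCompletion.toLim (AlgLimit G f)).toLinearMap :=
    CStarCompletion.denseRange (AlgLimit G f)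
  have hLa : ∀ y, L (CStarCompletion.toLim _ y) = algLift κ hκ y :=
    LinearMap.extendOfNorm_eq (f := algLift κ hκ) hd
      ⟨1, fun y => by
        rw [one_mul, norm_algLift hκ hn]; exact (CStarCompletion.norm_toLim y).ge⟩
  have hL : ∀ i x, L (of G f i x) = κ i x := fun i x => hLa _
  let κt : CStarLimit G f →⋆ₙₐ[ℂ] B :=
    { toFun := L
      map_smul' := fun c x => map_smul L c x
      map_zero' := map_zero L
      map_add' := map_add L
      map_mul' := fun x y => by
        refine induction₂ (p := fun x y => L (x * y) = L x * L y) x y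
          (isClosed_eq (L.continuous.comp continuous_mul)
            ((L.continuous.comp continuous_fst).mul (L.continuous.comp continuous_snd)))
          fun i x y => ?_
        rw [← map_mul, hL, hL, hL, map_mul]
      map_star' := fun x => by
        refine induction (p := fun x => L (star x) = star (L x)) x
          (isClosed_eq (L.continuous.comp continuous_star) L.continuous.star) fun i x => ?_
        rw [← map_star, hL, hL, map_star] }
  have hiso : Isometry κt := by
    refine AddMonoidHomClass.isometry_of_norm κt fun x => ?_
    refine CStarCompletion.induction_on x
      (isClosed_eq L.continuous.norm continuous_norm) fun y => ?_
    change ‖L _‖ = _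
    rw [hLa, norm_algLift hκ hn, CStarCompletion.norm_toLim]
  refine ⟨κt, hL, fun κ' h' => ?_, hiso, ?_⟩
  · refine DFunLike.ext _ _ fun x => ?_
    -- A competing *-homomorphism is automatically contractive, since the limit is a C*-algebra. So
    -- it is determined by its values on the images of the G i.
    have hc : Continuous κ' := AddMonoidHomClass.continuous_of_bound κ' 1 fun x => by
      simpa using NonUnitalStarAlgHom.norm_apply_le κ' x
    exact induction (p := fun x => κ' x = κt x) x (isClosed_eq hc L.continuous)
      fun i x => (h' i x).trans (hL i x).symm
  -- The range is closed because the limit is complete and the lift is isometric.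
  · refine subset_antisymm ?_ (closure_minimal ?_ hiso.isClosedEmbedding.isClosed_range)
    · rintro _ ⟨x, rfl⟩
      exact induction (p := fun x => κt x ∈ closure (⋃ i, Set.range (κ i))) x
        (isClosed_closure.preimage L.continuous)
        fun i x => subset_closure (Set.mem_iUnion.2 ⟨i, x, (hL i x).symm⟩)
    · refine Set.iUnion_subset fun i => ?_
      rintro _ ⟨x, rfl⟩
      exact ⟨of G f i x, hL i x⟩

end CStarLimit

/-! ### The isomorphism of the inductive limit with the core -/

theorem mainTheorem4 {ι : Type*} [Countable ι] [Nonempty ι] {A : Type*} [NonUnitalCStarAlgebra A]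
    {B : Type*} [NonUnitalCStarAlgebra B] (X : ProductSystem ι A) (hX : X.CompactlyAligned)
    (ψ : X.Rep B) (hinj : ψ.IsInjective) (hcnp : ψ.IsCNP hX) :
    ∃ κ : ∀ n : ι →₀ ℕ, ProductSystem.Ctilde hX n →⋆ₙₐ[ℂ] B,
      (∀ n (S : ∀ p : ProductSystem.below n, compacts A (X.fib p)),
        κ n (ProductSystem.Ctilde.mk hX n S) =
          ∑ p : ProductSystem.below n, ψ.onCompacts p (S p)) ∧
      (∀ n m (h : n ≤ m) (x : ProductSystem.Ctilde hX n),
        κ m (ProductSystem.jtilde hX n m h x) = κ n x) ∧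
      ∃ κt : CStarLimit (fun n => ProductSystem.Ctilde hX n) (ProductSystem.jtilde hX) →⋆ₙₐ[ℂ] B,
        (∀ n (x : ProductSystem.Ctilde hX n), κt (CStarLimit.of _ _ n x) = κ n x) ∧
        (∀ κ' : CStarLimit (fun n => ProductSystem.Ctilde hX n) (ProductSystem.jtilde hX) →⋆ₙₐ[ℂ] B,
          (∀ n (x : ProductSystem.Ctilde hX n), κ' (CStarLimit.of _ _ n x) = κ n x) → κ' = κt) ∧
        Isometry κt ∧ Set.range κt = (ψ.core : Set B) := by
  choose κ hκ using fun n => hcnp.exists_kappa n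
  have hmk : ∀ n (S : ∀ p : ProductSystem.below n, compacts A (X.fib p)),
      κ n (ProductSystem.Ctilde.mk hX n S) = ψ.sumOver (ProductSystem.below n) S :=
    fun n S => hcnp.snd_eq (hκ n _) ⟨S, rfl⟩
  have hj : ∀ n m (h : n ≤ m) (x : ProductSystem.Ctilde hX n),
      κ m (ProductSystem.jtilde hX n m h x) = κ n x := fun n m h x => by
    -- Both values are second coordinates over the same first coordinate, the restricted family at
    -- level m.
    refine hcnp.snd_eq (hκ m _) ?_
    obtain ⟨_, S, rfl⟩ := x
    rw [show κ n ⟨_, _⟩ = _ from hmk n S]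
    exact ProductSystem.Rep.tail_mem_pairs h S
  have hn : ∀ n x, ‖κ n x‖ = ‖x‖ := fun n x => hcnp.norm_snd_eq hinj (hκ n x)
  obtain ⟨κt, h1, h2, h3, h4⟩ := CStarLimit.exists_isometric_lift hj hn
  refine ⟨κ, fun n S => (hmk n S).trans (ProductSystem.Rep.sumOver_apply _ S), hj,
    κt, h1, h2, h3, ?_⟩
  rw [h4, ProductSystem.Rep.core_eq_closure]
  congr 1
  -- Every element of C̃_n is the family of some tuple S, so the range of κ̃_n is all of ∑_{p ≤ n}
  -- ψ^{(p)}(𝓚(X_p)).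
  refine Set.iUnion_congr fun n => subset_antisymm ?_ ?_
  · rintro _ ⟨⟨_, S, rfl⟩, rfl⟩
    exact ⟨S, (hmk n S).symm⟩
  · rintro _ ⟨S, rfl⟩
    exact ⟨_, hmk n S⟩
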